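/- Let $d\ge 4$ be an integer and $V=\mathbb{C}^2$. Let $W_d\subset GL(V)$ be the dihedral group of order $2d$ generated by the matrices $\begin{pmatrix}0&u\\u^{-1}&0\end{pmatrix}$ with $u\in\mathbb{C}$, $u^d=1$. Write $\mathbb{C}[V\times V^*]=\mathbb{C}[x,y,X,Y]$, where $(x,y)$ is the canonical basis of $V$ and $(X,Y)$ is the dual basis, with the induced action of $W_d$. Put $\delta=xX-yY$, $D=\delta^2$, and let $I=(\delta\,\mathbb{C}[V\times V^*])^{W_d}$, an ideal of $\mathbb{C}[V\times V^*]^{W_d}$. Let $$\mathcal{Y}(d)=\operatorname{Spec}\big(\mathbb{C}[V\times V^*]^{W_d}[I/D]\big)$$ be the affine chart, associated with $D\in I$, of the blowup of $(V\times V^*)/W_d$ along $I$, and let $0\in\mathcal{Y}(d)$ be the point at which the regular functions $$q=xy,\quad Q=XY,\quad e=xX+yY,\quad b_j=\frac{x^{d-j}Y^j-y^{d-j}X^j}{xX-yY}\quad(0\le j\le d)$$ all vanish. Then the variety $\mathcal{Y}(d)\setminus\{0\}$ (that is, its set of complex points with the classical topology) is simply connected. -/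

import Mathlib

noncomputable section

namespace DihedralBlowup

open MvPolynomial

/-- The polynomial ring `ℂ[V × V*]`, where `V = ℂ²`. The variables `inl 0, inl 1` are the canonical
basis `x, y` of `V` (linear functions on `V*`), the variables `inr 0, inr 1` are the dual basis
`X, Y` (linear functions on `V`). -/
abbrev Poly : Type := MvPolynomial (Fin 2 ⊕ Fin 2) ℂ

/-- The coordinate `x`. -/
def vx : Poly := X (Sum.inl 0)

/-- The coordinate `y`. -/
def vy : Poly := X (Sum.inl 1)

/-- The coordinate `X`. -/
def vX : Poly := X (Sum.inr 0)

/-- The coordinate `Y`. -/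
def vY : Poly := X (Sum.inr 1)

/-- The action of `GL(V)` on `ℂ[V × V*]` by algebra automorphisms: the natural action on the span
`V` of `x, y` and the contragredient action on the span `V*` of `X, Y`. -/
def act (g : GL (Fin 2) ℂ) : Poly →ₐ[ℂ] Poly :=
  aeval (Sum.elim
    (fun j => ∑ i, C ((g : Matrix (Fin 2) (Fin 2) ℂ) i j) * X (Sum.inl i))
    (fun j => ∑ i, C (((g⁻¹ : GL (Fin 2) ℂ) : Matrix (Fin 2) (Fin 2) ℂ) j i) * X (Sum.inr i)))

/-- The reflection `(0, u; u⁻¹, 0)` of `V`. -/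
def refl (u : ℂˣ) : GL (Fin 2) ℂ where
  val := !![0, (u : ℂ); ((u⁻¹ : ℂˣ) : ℂ), 0]
  inv := !![0, (u : ℂ); ((u⁻¹ : ℂˣ) : ℂ), 0]
  val_inv := by simp [Matrix.one_fin_two]
  inv_val := by simp [Matrix.one_fin_two]

/-- The dihedral group `W_d` of order `2d`, generated by the reflections
`s_j = (0, ζ^j; ζ^(-j), 0)`, `j ∈ ℤ/d`, where `ζ` is a primitive `d`-th root of unity; that is, by
the matrices `(0, u; u⁻¹, 0)` for all `d`-th roots of unity `u`. -/
def W (d : ℕ) : Subgroup (GL (Fin 2) ℂ) :=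
  Subgroup.closure (refl '' {u : ℂˣ | u ^ d = 1})

/-- The algebra of invariants `ℂ[V × V*]^{W_d}`. -/
def invariants (d : ℕ) : Subalgebra ℂ Poly where
  carrier := {f | ∀ w ∈ W d, act w f = f}
  mul_mem' ha hb w hw := by rw [map_mul, ha w hw, hb w hw]
  add_mem' ha hb w hw := by rw [map_add, ha w hw, hb w hw]
  algebraMap_mem' r w _ := AlgHom.commutes _ r

/-- `δ = xX - yY`. -/
def delta : Poly := vx * vX - vy * vY

/-- The ideal `I = (δ ℂ[V × V*])^{W_d}` of `ℂ[V × V*]^{W_d}`. -/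
def idealI (d : ℕ) : Ideal (invariants d) :=
  (Ideal.span {delta}).comap (invariants d).val

/-- The field of rational functions on `V × V*`. -/
abbrev RatFun : Type := FractionRing Poly

/-- The algebra `ℂ[V × V*]^{W_d}[I/D]`, where `D = δ²`: the subalgebra of the field of rational
functions generated by the invariants and by the quotients `f/D` with `f ∈ I`. -/
def chartAlgebra (d : ℕ) : Subalgebra ℂ RatFun :=
  Algebra.adjoin ℂ
    ({z | ∃ f : invariants d, z = algebraMap Poly RatFun (f : Poly)} ∪
     {z | ∃ f ∈ idealI d,
        z = algebraMap Poly RatFun (f : Poly) / algebraMap Poly RatFun (delta ^ 2)})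

/-- The set of complex points of the affine variety `𝒴(d) = Spec ℂ[V × V*]^{W_d}[I/D]`, the affine
chart `D ≠ 0` of the blowup of `(V × V*)/W_d` along `I`. -/
def Y (d : ℕ) : Type := chartAlgebra d →ₐ[ℂ] ℂ

/-- The value at the point `P` of the regular function `f`. -/
def Y.eval {d : ℕ} (P : Y d) (f : chartAlgebra d) : ℂ := (show chartAlgebra d →ₐ[ℂ] ℂ from P) f

/-- The classical (complex analytic) topology on `𝒴(d)`: the coarsest one for which all regular
functions are continuous. -/
instance (d : ℕ) : TopologicalSpace (Y d) :=
  TopologicalSpace.induced (fun P f => P.eval f) inferInstance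

/-- The semi-invariant `β_j = x^(d-j) Y^j - y^(d-j) X^j`. -/
def beta (d : ℕ) (j : Fin (d + 1)) : Poly :=
  vx ^ (d - (j : ℕ)) * vY ^ (j : ℕ) - vy ^ (d - (j : ℕ)) * vX ^ (j : ℕ)

theorem act_mul (g h : GL (Fin 2) ℂ) (f : Poly) : act (g * h) f = act g (act h f) := by
  have : act (g * h) = (act g).comp (act h) := by
    apply MvPolynomial.algHom_ext
    rintro (j | j)
    · simp [act, Matrix.mul_apply, Fin.sum_univ_two]
      ring
    · simp [act, Matrix.mul_apply, Fin.sum_univ_two, -Matrix.coe_units_inv]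
      ring
  rw [this]; rfl

theorem act_one (f : Poly) : act 1 f = f := by
  have : act 1 = AlgHom.id ℂ Poly := by
    apply MvPolynomial.algHom_ext
    rintro (j | j) <;> fin_cases j <;> simp [act, Fin.sum_univ_two]
  rw [this]; rfl

theorem mem_invariants {d : ℕ} {f : Poly} (hf : ∀ u : ℂˣ, u ^ d = 1 → act (refl u) f = f) :
    f ∈ invariants d := by
  intro w hw
  induction hw using Subgroup.closure_induction with
  | mem x hx => obtain ⟨u, hu, rfl⟩ := hx; exact hf u hu
  | one => exact act_one f
  | mul a b _ _ ha hb => rw [act_mul, hb, ha]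
  | inv a _ ha =>
    conv_lhs => rw [← ha]
    rw [← act_mul, inv_mul_cancel, act_one]

theorem refl_inv (u : ℂˣ) : (refl u)⁻¹ = refl u := Units.ext rfl

theorem act_vx (u : ℂˣ) : act (refl u) vx = C ((u⁻¹ : ℂˣ) : ℂ) * vy := by
  simp [act, vx, vy, refl, Fin.sum_univ_two]

theorem act_vy (u : ℂˣ) : act (refl u) vy = C (u : ℂ) * vx := by
  simp [act, vx, vy, refl, Fin.sum_univ_two]

theorem act_vX (u : ℂˣ) : act (refl u) vX = C (u : ℂ) * vY := by
  simp only [act, refl_inv]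
  simp [vX, vY, refl, Fin.sum_univ_two]

theorem act_vY (u : ℂˣ) : act (refl u) vY = C ((u⁻¹ : ℂˣ) : ℂ) * vX := by
  simp only [act, refl_inv]
  simp [vX, vY, refl, Fin.sum_univ_two]

theorem C_inv_mul (u : ℂˣ) : (C ((u⁻¹ : ℂˣ) : ℂ) : Poly) * C (u : ℂ) = 1 := by
  rw [← C_mul]; simp

theorem act_delta (u : ℂˣ) : act (refl u) delta = -delta := by
  simp only [delta, map_sub, map_mul, act_vx, act_vy, act_vX, act_vY]
  linear_combination (vy * vY - vx * vX) * C_inv_mul u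

theorem act_beta {d : ℕ} {u : ℂˣ} (hu : u ^ d = 1) (j : Fin (d + 1)) :
    act (refl u) (beta d j) = -beta d j := by
  have hj : d - (j : ℕ) + j = d := Nat.sub_add_cancel (Nat.lt_succ_iff.mp j.2)
  have h1 : (C (u : ℂ) : Poly) ^ (d - (j : ℕ)) * C (u : ℂ) ^ (j : ℕ) = 1 := by
    rw [← pow_add, hj, ← C_pow, ← Units.val_pow_eq_pow_val, hu]; simp
  have h2 : (C ((u⁻¹ : ℂˣ) : ℂ) : Poly) ^ (d - (j : ℕ)) * C ((u⁻¹ : ℂˣ) : ℂ) ^ (j : ℕ) = 1 := by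
    rw [← pow_add, hj, ← C_pow, ← Units.val_pow_eq_pow_val, inv_pow, hu]; simp
  simp only [beta, map_sub, map_mul, map_pow, act_vx, act_vy, act_vX, act_vY, mul_pow]
  linear_combination (vy ^ (d - (j : ℕ)) * vX ^ (j : ℕ)) * h2
    - (vx ^ (d - (j : ℕ)) * vY ^ (j : ℕ)) * h1

/-- An invariant polynomial, as a regular function on `𝒴(d)`. -/
def ofInvariant {d : ℕ} (f : Poly) (hf : f ∈ invariants d) : chartAlgebra d :=
  ⟨algebraMap Poly RatFun f, Algebra.subset_adjoin (Or.inl ⟨⟨f, hf⟩, rfl⟩)⟩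

/-- The regular function `q = xy`. -/
def q (d : ℕ) : chartAlgebra d :=
  ofInvariant (vx * vy) <| mem_invariants fun u _ => by
    simp only [map_mul, act_vx, act_vy]
    linear_combination (vx * vy) * C_inv_mul u

/-- The regular function `Q = XY`. -/
def Q (d : ℕ) : chartAlgebra d :=
  ofInvariant (vX * vY) <| mem_invariants fun u _ => by
    simp only [map_mul, act_vX, act_vY]
    linear_combination (vX * vY) * C_inv_mul u

/-- The regular function `e = xX + yY`. -/
def e (d : ℕ) : chartAlgebra d :=
  ofInvariant (vx * vX + vy * vY) <| mem_invariants fun u _ => by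
    simp only [map_mul, map_add, act_vx, act_vy, act_vX, act_vY]
    linear_combination (vx * vX + vy * vY) * C_inv_mul u

theorem delta_ne_zero : delta ≠ 0 := by
  intro h
  have h1 := congrArg (aeval (R := ℂ) (Sum.elim (fun i : Fin 2 => if i = 0 then (1 : ℂ) else 0)
    (fun _ => 1))) h
  simp [delta, vx, vy, vX, vY] at h1

theorem div_eq_mul_div_sq {F : Type} [Field F] {x y : F} (hy : y ≠ 0) :
    x / y = y * x / y ^ 2 := by
  field_simp

theorem algebraMap_delta_ne_zero : algebraMap Poly RatFun delta ≠ 0 := fun h =>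
  delta_ne_zero (IsFractionRing.injective Poly RatFun (h.trans (map_zero _).symm))

theorem delta_mul_beta_mem (d : ℕ) (j : Fin (d + 1)) : delta * beta d j ∈ invariants d :=
  mem_invariants fun u hu => by
    rw [map_mul, act_delta, act_beta hu]; ring

theorem delta_mul_beta_mem_idealI (d : ℕ) (j : Fin (d + 1)) :
    (⟨delta * beta d j, delta_mul_beta_mem d j⟩ : invariants d) ∈ idealI d := by
  change delta * beta d j ∈ Ideal.span {delta}
  exact Ideal.mul_mem_right _ _ (Ideal.mem_span_singleton_self _)

theorem div_mem_chartAlgebra {d : ℕ} (f : invariants d) (hf : f ∈ idealI d) :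
    algebraMap Poly RatFun (f : Poly) / algebraMap Poly RatFun (delta ^ 2) ∈ chartAlgebra d :=
  Algebra.subset_adjoin (Or.inr ⟨f, hf, rfl⟩)

theorem beta_div_delta_eq (d : ℕ) (j : Fin (d + 1)) :
    algebraMap Poly RatFun (beta d j) / algebraMap Poly RatFun delta =
      algebraMap Poly RatFun (delta * beta d j) / algebraMap Poly RatFun (delta ^ 2) := by
  rw [div_eq_mul_div_sq algebraMap_delta_ne_zero, map_pow, map_mul]

theorem beta_div_delta_mem (d : ℕ) (j : Fin (d + 1)) :
    algebraMap Poly RatFun (beta d j) / algebraMap Poly RatFun delta ∈ chartAlgebra d := by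
  rw [beta_div_delta_eq]
  exact div_mem_chartAlgebra ⟨_, delta_mul_beta_mem d j⟩ (delta_mul_beta_mem_idealI d j)

/-- The regular function `b_j = β_j/δ = (x^(d-j) Y^j - y^(d-j) X^j) / (xX - yY)`. -/
def b (d : ℕ) (j : Fin (d + 1)) : chartAlgebra d :=
  ⟨algebraMap Poly RatFun (beta d j) / algebraMap Poly RatFun delta, beta_div_delta_mem d j⟩

/-- The affine coordinates `(q, Q, e, b_0, …, b_d)` of a point of `𝒴(d)`, a point of `ℂ^(d+4)`. -/
def coords {d : ℕ} (P : Y d) : ℂ × ℂ × ℂ × (Fin (d + 1) → ℂ) :=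
  (P.eval (q d), P.eval (Q d), P.eval (e d), fun j => P.eval (b d j))

/-- `𝒴(d) ∖ {0}`, where `0` is the point whose coordinates `q, Q, e, b_0, …, b_d` all vanish. -/
def puncturedY (d : ℕ) : Set (Y d) := {P | coords P ≠ 0}

end DihedralBlowup

end

/-!
The pairs `v = (x, Y)` and `w = (y, X)` are vectors which the reflections in `W_d` exchange up to
scalars, `δ` is their determinant, `q, e, Q` are the coefficients of the quadratic form `v w`, and
the `b_j` are the coefficients, up to binomial factors, of the form `(v ^ d - w ^ d) / det(v, w)` of
degree `d`. These functions generate the algebra of `𝒴(d)` (`genAlgebra_eq_chartAlgebra`), so `𝒴(d)`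
is the closed subset `relVariety d` of `ℂ^(d+4)`.

* The open set `b₀ ≠ 0` is `ℂ³ × ℂˣ`, with coordinates `q, e, b₁` and `b₀`: the relations
  `ratB_quadratic` and `ratB_succ` express `Q` and the other `b_j` through these four, and every
  value of them occurs (`chartTuple_mem`).
* The group `SL₂` acts on `v, w` and commutes with `W_d`. Its unipotent elements, the shears
  `x ↦ x + ξ Y`, `y ↦ y + ξ X`, move this open set to open sets that cover `𝒴(d) ∖ {0}`
  (`mem_puncturedY_iff`), all of which contain the base point `q = e = b₁ = 0`, `b₀ = 1`.
* Two of these sets meet in a path-connected set (`joinedIn_chartSet`), namely the complement of a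
  hypersurface in `ℂ³ × ℂˣ`.
* The fundamental group of `ℂ³ × ℂˣ` is generated by a loop of `b₀` around `0`. It becomes trivial
  in `𝒴(d) ∖ {0}`, because the curve `q = Q = 1`, `e = 2`, `b_j = z - j` crosses `b₀ = 0` at `z = 0`
  and avoids the point `0` (`homotopic_of_mem_chartSet`).

The generation part of van Kampen's theorem (`simplyConnectedSpace_of_cover`) concludes.
-/

noncomputable section

namespace DihedralBlowup

open scoped unitInterval

/-! ### Paths and coverings -/

theorem homotopic_of_trans_left {X : Type*} [TopologicalSpace X] {x y z : X} {c : Path x y}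
    {γ γ' : Path y z} (h : (c.trans γ).Homotopic (c.trans γ')) : γ.Homotopic γ' := by
  have h1 : (c.symm.trans (c.trans γ)).Homotopic (c.symm.trans (c.trans γ')) :=
    Path.Homotopic.hcomp (.refl _) h
  have key : ∀ g : Path y z, (c.symm.trans (c.trans g)).Homotopic g := by
    intro g
    refine Path.Homotopic.trans ⟨(Path.Homotopy.transAssoc _ _ _).symm⟩ ?_
    refine Path.Homotopic.trans (Path.Homotopic.hcomp ⟨(Path.Homotopy.reflSymmTrans c).symm⟩
      (.refl g)) ?_
    exact ⟨Path.Homotopy.reflTrans g⟩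
  exact (key γ).symm.trans (h1.trans (key γ'))

/-- The generation half of van Kampen's theorem: if the members of an open cover contain a common
base point `p`, meet pairwise in path-connected sets, and any two paths from `p` inside one member
are homotopic in the whole space, then the space is simply connected. The paths from `p` that stay
in one member then give a well-defined homotopy class at each point, and by subdividing a path into
pieces each lying in one member, these classes are seen to be compatible with every path. -/
theorem simplyConnectedSpace_of_cover {X ι : Type*} [TopologicalSpace X] (U : ι → Set X)
    (hU : ∀ i, IsOpen (U i)) (p : X) (hcover : ∀ x, ∃ i, x ∈ U i)
    (hjoin : ∀ i j x, x ∈ U i → x ∈ U j → JoinedIn (U i ∩ U j) p x)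
    (hhom : ∀ i x (γ γ' : Path p x), (∀ t, γ t ∈ U i) → (∀ t, γ' t ∈ U i) → γ.Homotopic γ') :
    SimplyConnectedSpace X := by
  -- A path from `p` staying in one member is determined up to homotopy by its endpoint.
  have indep : ∀ i j x (c c' : Path p x), (∀ t, c t ∈ U i) → (∀ t, c' t ∈ U j) →
      c.Homotopic c' := by
    intro i j x c c' hc hc'
    obtain ⟨c₀, h₀⟩ := hjoin i j x (by simpa using hc 1) (by simpa using hc' 1)
    exact (hhom i x c c₀ hc fun t => (h₀ t).1).trans (hhom j x c₀ c' (fun t => (h₀ t).2) hc')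
  have hpath : ∀ i x, x ∈ U i → ∃ c : Path p x, ∀ t, c t ∈ U i := by
    intro i x hx
    obtain ⟨c, hc⟩ := hjoin i i x hx hx
    exact ⟨c, fun t => (hc t).1⟩
  have main : ∀ a b (γ : Path a b) (i j) (c₀ : Path p a) (c : Path p b), (∀ t, c₀ t ∈ U i) →
      (∀ t, c t ∈ U j) → (c₀.trans γ).Homotopic c := by
    intro a b γ i j c₀ c h₀ hc
    obtain ⟨t, ht0, tmono, ⟨m, hm⟩, ht⟩ := exists_monotone_Icc_subset_open_cover_unitInterval
      (c := fun i => γ ⁻¹' U i) (fun i => (hU i).preimage γ.continuous) (fun s _ => by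
        obtain ⟨i, hi⟩ := hcover (γ s)
        exact Set.mem_iUnion.2 ⟨i, hi⟩)
    have step : ∀ n k (c : Path p (γ (t n))), (∀ s, c s ∈ U k) →
        ((c₀.cast rfl γ.source).trans (γ.subpath 0 (t n))).Homotopic c := by
      intro n
      induction n with
      | zero =>
        rw [ht0]
        intro k c hc
        rw [Path.subpath_self]
        exact Path.Homotopic.trans ⟨Path.Homotopy.transRefl _⟩ (indep i k _ _ _ h₀ hc)
      | succ n ih =>
        intro k c hc
        obtain ⟨l, hl⟩ := ht n
        obtain ⟨c₁, hc₁⟩ := hpath l (γ (t n)) (hl ⟨le_rfl, tmono n.le_succ⟩)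
        have h1 := ih l c₁ hc₁
        have h2 : ((γ.subpath 0 (t n)).trans (γ.subpath (t n) (t (n + 1)))).Homotopic
            (γ.subpath 0 (t (n + 1))) := ⟨Path.Homotopy.subpathTransSubpath γ _ _ _⟩
        have h3 : (c₁.trans (γ.subpath (t n) (t (n + 1)))).Homotopic c := by
          refine indep l k _ _ _ (fun s => ?_) hc
          have hs : (c₁.trans (γ.subpath (t n) (t (n + 1)))) s ∈
              Set.range (c₁.trans (γ.subpath (t n) (t (n + 1)))) := ⟨s, rfl⟩
          rw [Path.trans_range, Path.range_subpath_of_le _ _ _ (tmono n.le_succ)] at hs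
          rcases hs with ⟨u, hu⟩ | ⟨u, hu, hu'⟩
          · rw [← hu]; exact hc₁ u
          · rw [← hu']; exact hl hu
        refine Path.Homotopic.trans (Path.Homotopic.hcomp (.refl _) h2.symm) ?_
        refine Path.Homotopic.trans ⟨(Path.Homotopy.transAssoc _ _ _).symm⟩ ?_
        exact (Path.Homotopic.hcomp h1 (.refl _)).trans h3
    have h := step m
    rw [hm m le_rfl, Path.subpath_zero_one] at h
    exact h j (c.cast rfl γ.target) hc
  have hp : ∀ x, Joined p x := fun x => by
    obtain ⟨i, hi⟩ := hcover x
    exact (hpath i x hi).nonempty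
  refine simply_connected_iff_paths_homotopic'.2
    ⟨⟨⟨p⟩, fun x y => (hp x).symm.trans (hp y)⟩, fun {x y} γ γ' => ?_⟩
  obtain ⟨i, hi⟩ := hcover x
  obtain ⟨j, hj⟩ := hcover y
  obtain ⟨c₀, h₀⟩ := hpath i x hi
  obtain ⟨c, hc⟩ := hpath j y hj
  exact homotopic_of_trans_left
    ((main x y γ i j c₀ c h₀ hc).trans (main x y γ' i j c₀ c h₀ hc).symm)

/-- Paths that lift, with common endpoints, through a map from a simply connected space are
homotopic. -/
theorem homotopic_of_lifts {E X : Type*} [TopologicalSpace E] [TopologicalSpace X]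
    [SimplyConnectedSpace E] {f : E → X} (hf : Continuous f) {a b : E} {x y : X}
    {Γ Γ' : Path a b} {γ γ' : Path x y} (h : ∀ t, f (Γ t) = γ t) (h' : ∀ t, f (Γ' t) = γ' t) :
    γ.Homotopic γ' := by
  obtain rfl : f a = x := by simpa using h 0
  obtain rfl : f b = y := by simpa using h 1
  obtain rfl : Γ.map hf = γ := Path.ext (funext h)
  obtain rfl : Γ'.map hf = γ' := Path.ext (funext h')
  exact (SimplyConnectedSpace.paths_homotopic Γ Γ').map ⟨f, hf⟩

theorem trans_lifts {E X : Type*} [TopologicalSpace E] [TopologicalSpace X] {f : E → X}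
    {a b c : E} {x y z : X} {Γ : Path a b} {Γ' : Path b c} {γ : Path x y} {γ' : Path y z}
    (h : ∀ t, f (Γ t) = γ t) (h' : ∀ t, f (Γ' t) = γ' t) (t : I) :
    f ((Γ.trans Γ') t) = (γ.trans γ') t := by
  simp only [Path.trans_apply]
  split_ifs
  · exact h _
  · exact h' _

/-- If `E` is simply connected, `f : E → X` is invariant under `T : E → E`, and some path from a
point `m` to `T m` becomes null-homotopic in `X`, then two paths of `X` are homotopic as soon as
they have lifts with the same source whose targets differ by `T`. The second path is homotopic to
the image of a path that goes to `m`, then to `T m`, then back along the first leg moved by `T`, and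
finally follows the first lift moved by `T`. -/
theorem homotopic_of_deck {E X : Type*} [TopologicalSpace E] [TopologicalSpace X]
    [SimplyConnectedSpace E] {f : E → X} (hf : Continuous f) {T : E → E} (hT : Continuous T)
    (hfT : ∀ u, f (T u) = f u) {m : E} {L : Path m (T m)} {ℓ : Path (f m) (f m)}
    (hL : ∀ t, f (L t) = ℓ t) (hℓ : ℓ.Homotopic (.refl _))
    {a b : E} {x y : X} {Γ : Path a b} {Γ' : Path a (T b)} {γ γ' : Path x y}
    (h : ∀ t, f (Γ t) = γ t) (h' : ∀ t, f (Γ' t) = γ' t) : γ.Homotopic γ' := by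
  obtain rfl : f a = x := by simpa using h 0
  obtain rfl : f b = y := by simpa using h 1
  have S : Path a m := PathConnectedSpace.somePath a m
  have hS : ∀ t, f (S t) = (S.map hf) t := fun t => rfl
  have hTS : ∀ t, f ((S.symm.map hT) t) = (S.map hf).symm t := fun t => hfT _
  have hTΓ : ∀ t, f ((Γ.map hT) t) = γ t := fun t => (hfT _).trans (h t)
  have h1 : γ'.Homotopic ((S.map hf).trans (ℓ.trans ((S.map hf).symm.trans γ))) :=
    homotopic_of_lifts hf h' (trans_lifts hS (trans_lifts hL (trans_lifts hTS hTΓ)))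
  refine Path.Homotopic.symm (h1.trans ?_)
  refine Path.Homotopic.trans (Path.Homotopic.hcomp (.refl _) (Path.Homotopic.trans
    (Path.Homotopic.hcomp hℓ (.refl _)) ⟨Path.Homotopy.reflTrans _⟩)) ?_
  refine Path.Homotopic.trans ⟨(Path.Homotopy.transAssoc _ _ _).symm⟩ ?_
  refine Path.Homotopic.trans (Path.Homotopic.hcomp
    ⟨(Path.Homotopy.reflTransSymm _).symm⟩ (.refl _)) ?_
  exact ⟨Path.Homotopy.reflTrans _⟩

/-- A path of nonzero complex numbers starting at `1` has a continuous logarithm starting at `0`. -/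
theorem exists_exp_lift (g : I → ℂ) (hg : Continuous g) (hg0 : ∀ t, g t ≠ 0) (h0 : g 0 = 1) :
    ∃ w : I → ℂ, Continuous w ∧ w 0 = 0 ∧ ∀ t, Complex.exp (w t) = g t := by
  obtain ⟨Γ, h1, h2⟩ := Complex.isCoveringMap_exp.exists_path_lifts
    (⟨fun t => ⟨g t, hg0 t⟩, by fun_prop⟩ : C(I, {z : ℂ // z ≠ 0})) 0 (by simp [h0])
  exact ⟨Γ, Γ.continuous, h2, fun t => congrArg Subtype.val (congrFun h1 t)⟩

/-! ### Identities between the coordinates -/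

/-- The Lucas sequence `U n`, with `(α - β) U n = α ^ n - β ^ n` when `e = α + β`, `w = α β`. -/
def lucas {R : Type*} [CommRing R] (e w : R) : ℕ → R
  | 0 => 0
  | 1 => 1
  | n + 2 => e * lucas e w (n + 1) - w * lucas e w n

theorem lucas_mul_sub {R : Type*} [CommRing R] (a b : R) (n : ℕ) :
    (a - b) * lucas (a + b) (a * b) n = a ^ n - b ^ n := by
  induction n using Nat.twoStepInduction with
  | zero => simp [lucas]
  | one => simp [lucas]
  | more n h0 h1 =>
    rw [lucas, mul_sub, mul_left_comm, h1, mul_left_comm, h0]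
    ring

theorem lucas_scale {R : Type*} [CommRing R] (e w c : R) (n : ℕ) :
    lucas (c * e) (c ^ 2 * w) (n + 1) = c ^ n * lucas e w (n + 1) := by
  induction n using Nat.twoStepInduction with
  | zero => simp [lucas]
  | one => simp [lucas]
  | more n h0 h1 =>
    rw [lucas, h1, h0, lucas.eq_3 e w (n + 1)]
    ring

theorem map_lucas {R S F : Type*} [CommRing R] [CommRing S] [FunLike F R S] [RingHomClass F R S]
    (φ : F) (e w : R) (n : ℕ) : φ (lucas e w n) = lucas (φ e) (φ w) n := by
  induction n using Nat.twoStepInduction with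
  | zero => simp [lucas]
  | one => simp [lucas]
  | more n h0 h1 => simp [lucas, h0, h1]

theorem lucas_two_one (n : ℕ) : lucas (2 : ℂ) 1 n = n := by
  induction n using Nat.twoStepInduction with
  | zero => simp [lucas]
  | one => simp [lucas]
  | more n h0 h1 =>
    rw [lucas, h0, h1]
    push_cast; ring

section Field

variable {K : Type*} [Field K]

/-- The value `(x^(d-j) Y^j - y^(d-j) X^j) / (xX - yY)` of `b_j`, in an arbitrary field; meaningful
for `j ≤ d` and `xX ≠ yY`. -/
def ratB (d : ℕ) (x y X Y : K) (j : ℕ) : K :=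
  (x ^ (d - j) * Y ^ j - y ^ (d - j) * X ^ j) / (x * X - y * Y)

/-- On the locus `b₀ ≠ 0` this relation gives `Q` in terms of `q, e, b₁, b₀`. -/
theorem ratB_quadratic {d : ℕ} (hd : 1 ≤ d) {x y X Y : K} (h : x * X - y * Y ≠ 0) :
    ratB d x y X Y 0 ^ 2 * (X * Y)
      = (x * X + y * Y) * ratB d x y X Y 0 * ratB d x y X Y 1
        - x * y * ratB d x y X Y 1 ^ 2 + (x * y) ^ (d - 1) := by
  obtain ⟨n, rfl⟩ : ∃ n, d = n + 1 := ⟨d - 1, by omega⟩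
  simp only [ratB, Nat.add_sub_cancel, Nat.sub_zero]
  field_simp
  ring

/-- On the locus `b₀ ≠ 0` these relations give all `b_j` in terms of `q, e, b₁, b₀`. -/
theorem ratB_succ {d j : ℕ} (hj : j < d) {x y X Y : K} (h : x * X - y * Y ≠ 0) :
    ratB d x y X Y 0 * ratB d x y X Y (j + 1)
      = ratB d x y X Y 1 * ratB d x y X Y j
        - (x * y) ^ (d - 1 - j) * lucas (x * X + y * Y) (x * y * (X * Y)) j := by
  obtain ⟨m, rfl⟩ : ∃ m, d = m + j + 1 := ⟨d - 1 - j, by omega⟩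
  have hl := lucas_mul_sub (x * X) (y * Y) j
  rw [show x * X * (y * Y) = x * y * (X * Y) by ring, mul_comm] at hl
  rw [eq_div_of_mul_eq h hl]
  simp only [ratB, show m + j + 1 - j = m + 1 by omega, show m + j + 1 - (j + 1) = m by omega,
    show m + j + 1 - 1 = m + j by omega, show m + j - j = m by omega, Nat.sub_zero]
  field_simp
  ring

/-- The coordinate `Q` on the locus `b₀ ≠ 0`, as a function of `q, e, b₁, b₀`. -/
def chartQ (d : ℕ) (q e b₁ b₀ : K) : K := (e * b₀ * b₁ - q * b₁ ^ 2 + q ^ (d - 1)) / b₀ ^ 2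

/-- The coordinates `b_j`, `j ≤ d`, on the locus `b₀ ≠ 0`, as functions of `q, e, b₁, b₀`; the
values for `j > d` have no meaning. -/
def chartB (d : ℕ) (q e b₁ b₀ : K) : ℕ → K
  | 0 => b₀
  | j + 1 => (b₁ * chartB d q e b₁ b₀ j
      - q ^ (d - 1 - j) * lucas e (q * chartQ d q e b₁ b₀) j) / b₀

theorem eq_chartB {d : ℕ} {q Q e : K} {β : ℕ → K} (h0 : β 0 ≠ 0)
    (hQ : β 0 ^ 2 * Q = e * β 0 * β 1 - q * β 1 ^ 2 + q ^ (d - 1))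
    (hβ : ∀ j < d, β 0 * β (j + 1) = β 1 * β j - q ^ (d - 1 - j) * lucas e (q * Q) j) :
    Q = chartQ d q e (β 1) (β 0) ∧ ∀ j ≤ d, β j = chartB d q e (β 1) (β 0) j := by
  have h1 : Q = chartQ d q e (β 1) (β 0) := by
    rw [chartQ, ← hQ]; field_simp
  refine ⟨h1, fun j => ?_⟩
  induction j with
  | zero => intro _; rfl
  | succ j ih =>
    intro hj
    rw [chartB, ← ih (by omega), ← h1, ← hβ j hj]
    field_simp

theorem chartQ_scale (k : ℕ) (q e b₁ b₀ l : K) :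
    chartQ (k + 2) (l ^ 2 * q) (l ^ (k + 2) * e) (l ^ k * b₁) b₀
      = l ^ (2 * k + 2) * chartQ (k + 2) q e b₁ b₀ := by
  simp only [chartQ, show k + 2 - 1 = k + 1 by omega]
  ring

/-- The coordinates are homogeneous when `q, e, b₁, b₀` have weights `2, d, d - 2, 0`: this is the
weight for which `x, y` have weight `1` and `X, Y` have weight `d - 1`. -/
theorem chartB_scale (k : ℕ) (q e b₁ b₀ l : K) (j : ℕ) (hj : j ≤ k + 2) :
    chartB (k + 2) (l ^ 2 * q) (l ^ (k + 2) * e) (l ^ k * b₁) b₀ j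
      = l ^ (k * j) * chartB (k + 2) q e b₁ b₀ j := by
  induction j with
  | zero => simp [chartB]
  | succ j ih =>
    rw [chartB, chartB, ih (by omega), chartQ_scale]
    rcases j with _ | i
    · simp only [lucas]
      ring
    · obtain ⟨r, rfl⟩ : ∃ r, k = i + r := ⟨k - i, by omega⟩
      rw [show l ^ 2 * q * (l ^ (2 * (i + r) + 2) * chartQ (i + r + 2) q e b₁ b₀)
        = (l ^ (i + r + 2)) ^ 2 * (q * chartQ (i + r + 2) q e b₁ b₀) by ring, lucas_scale,
        show i + r + 2 - 1 - (i + 1) = r by omega]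
      ring

theorem chartB_origin (k : ℕ) (hk : k ≠ 0) (b₀ : K) (j : ℕ) (hj : j < k + 2) :
    chartB (k + 2) 0 0 0 b₀ (j + 1) = 0 := by
  have h := chartB_scale k 0 0 0 b₀ 0 (j + 1) hj
  simpa [hk] using h

end Field

/-- Along the curve `q = 1`, `e = 2`, `b₁ = z - 1`, `b₀ = z` all coordinates are polynomials in `z`,
so the curve extends over `z = 0`. -/
theorem chart_disc {d : ℕ} {z : ℂ} (hz : z ≠ 0) :
    chartQ d 1 2 (z - 1) z = 1 ∧ ∀ j, chartB d 1 2 (z - 1) z j = z - j := by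
  have h1 : chartQ d 1 2 (z - 1) z = 1 := by
    simp only [chartQ]
    field_simp
    ring
  refine ⟨h1, fun j => ?_⟩
  induction j with
  | zero => simp [chartB]
  | succ j ih =>
    rw [chartB, ih, h1, mul_one, lucas_two_one]
    push_cast
    field_simp
    ring

/-- Where `b₀` and the discriminant `a ^ 2 - 4 q ^ d`, with `a = e b₀ - 2 q b₁`, do not vanish, the
values of `q, e, b₁, b₀` come from a point of `ℂ⁴` with `xX ≠ yY`. The numbers `x ^ d`, `y ^ d` have
sum `a` and product `q ^ d`, and the equations for `b₁`, `b₀` are linear in `X`, `Y`. -/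
theorem exists_point_of_chart {d : ℕ} (hd : 2 ≤ d) {q e b₁ b₀ : ℂ} (h0 : b₀ ≠ 0)
    (hdisc : (e * b₀ - 2 * q * b₁) ^ 2 ≠ 4 * q ^ d) :
    ∃ x y X Y : ℂ, x * X - y * Y ≠ 0 ∧ x * y = q ∧ x * X + y * Y = e ∧
      ratB d x y X Y 1 = b₁ ∧ ratB d x y X Y 0 = b₀ := by
  set a := e * b₀ - 2 * q * b₁ with ha
  obtain ⟨n, rfl⟩ : ∃ n, d = n + 1 := ⟨d - 1, by omega⟩
  obtain ⟨t₁, t₂, h1, hne, hadd, hmul⟩ : ∃ t₁ t₂ : ℂ, t₁ ≠ 0 ∧ t₁ - t₂ ≠ 0 ∧ t₁ + t₂ = a ∧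
      t₁ * t₂ = q ^ (n + 1) := by
    obtain ⟨s, hs⟩ := IsAlgClosed.exists_pow_nat_eq (a ^ 2 - 4 * q ^ (n + 1)) (n := 2) (by norm_num)
    have hs0 : s ≠ 0 := by
      rintro rfl
      apply hdisc
      linear_combination -hs
    -- Name the two distinct roots so that the first one is nonzero.
    by_cases h : a + s = 0
    · refine ⟨(a - s) / 2, (a + s) / 2, fun h' => hs0 ?_, fun h' => hs0 ?_, by ring, ?_⟩
      · linear_combination h / 2 - h'
      · linear_combination -h'
      · linear_combination -hs / 4
    · refine ⟨(a + s) / 2, (a - s) / 2, fun h' => h ?_, fun h' => hs0 ?_, by ring, ?_⟩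
      · linear_combination 2 * h'
      · linear_combination h'
      · linear_combination -hs / 4
  obtain ⟨x, hx⟩ := IsAlgClosed.exists_pow_nat_eq t₁ (n := n + 1) (by omega)
  have hx0 : x ≠ 0 := by
    rintro rfl
    exact h1 (by rw [← hx]; simp)
  obtain ⟨y, hxy⟩ : ∃ y, x * y = q := ⟨q / x, by field_simp⟩
  have hy : y ^ (n + 1) = t₂ := by
    apply mul_left_cancel₀ h1
    rw [hmul, ← hxy, mul_pow, hx]
  have hδ : x * ((y * b₁ + x ^ n) / b₀) - y * ((x * b₁ + y ^ n) / b₀) = (t₁ - t₂) / b₀ := by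
    rw [← hx, ← hy]; field_simp; ring
  refine ⟨x, y, (y * b₁ + x ^ n) / b₀, (x * b₁ + y ^ n) / b₀, ?_, hxy, ?_, ?_, ?_⟩
  · rw [hδ]; exact div_ne_zero hne h0
  · field_simp
    linear_combination 2 * b₁ * hxy + hx + hy + hadd + ha
  · rw [ratB, hδ, div_eq_iff (div_ne_zero hne h0), ← hx, ← hy]
    simp only [Nat.add_sub_cancel]
    field_simp
    ring
  · rw [ratB, hδ, div_eq_iff (div_ne_zero hne h0), ← hx, ← hy]
    simp only [Nat.sub_zero]
    field_simp

theorem dense_discriminant_ne (d : ℕ) (q b₁ : ℂ) {b₀ : ℂ} (h0 : b₀ ≠ 0) :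
    Dense {e : ℂ | (e * b₀ - 2 * q * b₁) ^ 2 ≠ 4 * q ^ d} := by
  obtain ⟨s, hs⟩ := IsAlgClosed.exists_pow_nat_eq (4 * q ^ d) (n := 2) (by norm_num)
  have hfin : ({(2 * q * b₁ + s) / b₀, (2 * q * b₁ - s) / b₀} : Set ℂ).Finite := by simp
  refine (hfin.countable.dense_compl ℝ).mono fun e he h => ?_
  apply he
  rw [← hs, sq_eq_sq_iff_eq_or_eq_neg] at h
  rcases h with h | h
  · left
    field_simp
    linear_combination h
  · right
    rw [Set.mem_singleton_iff]
    field_simp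
    linear_combination h

section Algebra

open MvPolynomial

/-! ### Monomials fixed by the rotations -/

theorem pow_mul_pow_mem {F : Type*} [Field F] [Algebra ℂ F] (G : Subalgebra ℂ F) {d : ℕ}
    {v w : F} (h : ∀ j ≤ d, v ^ (d - j) * w ^ j ∈ G) (n : ℕ) :
    ∀ i l, i + l = d * n → v ^ i * w ^ l ∈ G := by
  induction n with
  | zero =>
    intro i l hil
    obtain ⟨rfl, rfl⟩ : i = 0 ∧ l = 0 := by simpa using hil
    simp
  | succ n ih =>
    intro i l hil
    rw [mul_add, mul_one] at hil
    rcases le_total l d with hl | hl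
    · have := G.mul_mem (h l hl) (ih (i - (d - l)) 0 (by omega))
      rw [pow_zero, mul_one, mul_right_comm, ← pow_add] at this
      rwa [show d - l + (i - (d - l)) = i by omega] at this
    · have := G.mul_mem (h d le_rfl) (ih i (l - d) (by omega))
      rw [Nat.sub_self, pow_zero, one_mul, mul_left_comm, ← pow_add] at this
      rwa [show d + (l - d) = l by omega] at this

/-- The monomials fixed by the rotations are products of the quadratic ones `xy`, `xX`, `yY`, `XY`
and of `x^(d-j) Y^j`, `y^(d-j) X^j`. -/
theorem monomial_mem {F : Type*} [Field F] [Algebra ℂ F] (G : Subalgebra ℂ F) {d : ℕ}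
    {x y X Y : F} (h1 : x * y ∈ G) (h2 : x * X ∈ G) (h3 : y * Y ∈ G) (h4 : X * Y ∈ G)
    (h5 : ∀ j ≤ d, x ^ (d - j) * Y ^ j ∈ G) (h6 : ∀ j ≤ d, y ^ (d - j) * X ^ j ∈ G) (N : ℕ) :
    ∀ i j k l, i + j + k + l = N → i + l ≡ j + k [MOD d] →
      x ^ i * y ^ j * X ^ k * Y ^ l ∈ G := by
  induction N using Nat.strong_induction_on with
  | _ N ih =>
    intro i j k l hN hmod
    have hcancel : ∀ a b : ℕ, 1 + a ≡ 1 + b [MOD d] → a ≡ b [MOD d] :=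
      fun a b h => Nat.ModEq.add_left_cancel' 1 h
    by_cases hil : i = 0 ∧ l = 0
    · obtain ⟨rfl, rfl⟩ := hil
      obtain ⟨n, hn⟩ := (Nat.modEq_zero_iff_dvd).1 hmod.symm
      simpa using pow_mul_pow_mem G h6 n j k hn
    by_cases hjk : j = 0 ∧ k = 0
    · obtain ⟨rfl, rfl⟩ := hjk
      obtain ⟨n, hn⟩ := (Nat.modEq_zero_iff_dvd).1 hmod
      simpa using pow_mul_pow_mem G h5 n i l hn
    rcases Nat.eq_zero_or_pos i with hi | hi
    · obtain ⟨l, rfl⟩ : ∃ l', l = 1 + l' := ⟨l - 1, by omega⟩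
      rcases Nat.eq_zero_or_pos j with hj | hj
      · obtain ⟨k, rfl⟩ : ∃ k', k = 1 + k' := ⟨k - 1, by omega⟩
        convert! G.mul_mem h4 (ih _ (by omega) i j k l rfl
          (hcancel _ _ (by rwa [Nat.add_left_comm, Nat.add_left_comm 1 j]))) using 1
        ring
      · obtain ⟨j, rfl⟩ : ∃ k', j = 1 + k' := ⟨j - 1, by omega⟩
        convert! G.mul_mem h3 (ih _ (by omega) i j k l rfl
          (hcancel _ _ (by rwa [Nat.add_left_comm, ← Nat.add_assoc 1 j]))) using 1
        ring
    · obtain ⟨i, rfl⟩ : ∃ l', i = 1 + l' := ⟨i - 1, by omega⟩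
      rcases Nat.eq_zero_or_pos j with hj | hj
      · obtain ⟨k, rfl⟩ : ∃ k', k = 1 + k' := ⟨k - 1, by omega⟩
        convert! G.mul_mem h2 (ih _ (by omega) i j k l rfl
          (hcancel _ _ (by rwa [← Nat.add_assoc, Nat.add_left_comm 1 j]))) using 1
        ring
      · obtain ⟨j, rfl⟩ : ∃ k', j = 1 + k' := ⟨j - 1, by omega⟩
        convert! G.mul_mem h1 (ih _ (by omega) i j k l rfl
          (hcancel _ _ (by rwa [← Nat.add_assoc, ← Nat.add_assoc 1 j]))) using 1
        ring

/-! ### Generators of the algebra of regular functions -/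

/-- The coordinate `x`, as a rational function. -/
def rx : RatFun := algebraMap Poly RatFun vx

/-- The coordinate `y`, as a rational function. -/
def ry : RatFun := algebraMap Poly RatFun vy

/-- The coordinate `X`, as a rational function. -/
def rX : RatFun := algebraMap Poly RatFun vX

/-- The coordinate `Y`, as a rational function. -/
def rY : RatFun := algebraMap Poly RatFun vY

theorem algebraMap_delta : algebraMap Poly RatFun delta = rx * rX - ry * rY := by
  simp [delta, rx, ry, rX, rY]

theorem r_delta_ne_zero : rx * rX - ry * rY ≠ 0 := algebraMap_delta ▸ algebraMap_delta_ne_zero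

theorem coe_q (d : ℕ) : (q d : RatFun) = rx * ry := map_mul _ _ _
theorem coe_Q (d : ℕ) : (Q d : RatFun) = rX * rY := map_mul _ _ _
theorem coe_e (d : ℕ) : (e d : RatFun) = rx * rX + ry * rY := by
  simp [e, ofInvariant, rx, ry, rX, rY]
theorem coe_b (d : ℕ) (j : Fin (d + 1)) : (b d j : RatFun) = ratB d rx ry rX rY j := by
  simp [b, ratB, beta, delta, rx, ry, rX, rY]

/-- The functions `q, Q, e, b_0, …, b_d`. -/
def gen (d : ℕ) : Fin 3 ⊕ Fin (d + 1) → chartAlgebra d := Sum.elim ![q d, Q d, e d] (b d)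

/-- The automorphism of the field of rational functions induced by an automorphism of `Poly`. -/
def ratAut (φ : Poly ≃ₐ[ℂ] Poly) : RatFun ≃ₐ[ℂ] RatFun :=
  IsFractionRing.algEquivOfAlgEquiv φ

theorem ratAut_algebraMap (φ : Poly ≃ₐ[ℂ] Poly) (f : Poly) :
    ratAut φ (algebraMap Poly RatFun f) = algebraMap Poly RatFun (φ f) := by
  simp [ratAut]

theorem refl_mul_self (u : ℂˣ) : refl u * refl u = 1 := by
  rw [mul_eq_one_iff_eq_inv, refl_inv]

/-- The involution `x ↔ y`, `X ↔ Y` of the field of rational functions: the action of `refl 1`. -/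
def swap : RatFun ≃ₐ[ℂ] RatFun :=
  ratAut (AlgEquiv.ofAlgHom (act (refl 1)) (act (refl 1))
    (AlgHom.ext fun f => by
      rw [AlgHom.comp_apply, ← act_mul, refl_mul_self, act_one, AlgHom.id_apply])
    (AlgHom.ext fun f => by
      rw [AlgHom.comp_apply, ← act_mul, refl_mul_self, act_one, AlgHom.id_apply]))

theorem swap_algebraMap (f : Poly) :
    swap (algebraMap Poly RatFun f) = algebraMap Poly RatFun (act (refl 1) f) :=
  ratAut_algebraMap _ f

theorem swap_rx : swap rx = ry := by rw [rx, swap_algebraMap, act_vx]; simp [ry]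
theorem swap_ry : swap ry = rx := by rw [ry, swap_algebraMap, act_vy]; simp [rx]
theorem swap_rX : swap rX = rY := by rw [rX, swap_algebraMap, act_vX]; simp [rY]
theorem swap_rY : swap rY = rX := by rw [rY, swap_algebraMap, act_vY]; simp [rX]

theorem map_ratB {K L F : Type*} [Field K] [Field L] [FunLike F K L] [RingHomClass F K L] (φ : F)
    (d : ℕ) (x y X Y : K) (j : ℕ) :
    φ (ratB d x y X Y j) = ratB d (φ x) (φ y) (φ X) (φ Y) j := by
  simp [ratB]

theorem ratB_swap {K : Type*} [Field K] (d : ℕ) (x y X Y : K) (j : ℕ) :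
    ratB d y x Y X j = ratB d x y X Y j := by
  rw [ratB, ratB, ← neg_sub, ← neg_sub (x * X), neg_div_neg_eq]

/-- The subalgebra generated by `q, Q, e, b_0, …, b_d`. -/
def genAlgebra (d : ℕ) : Subalgebra ℂ RatFun :=
  Algebra.adjoin ℂ (Set.range fun i => (gen d i : RatFun))

theorem gen_mem (d : ℕ) (i) : (gen d i : RatFun) ∈ genAlgebra d :=
  Algebra.subset_adjoin ⟨i, rfl⟩

theorem q_mem (d : ℕ) : rx * ry ∈ genAlgebra d := coe_q d ▸ gen_mem d (Sum.inl 0)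
theorem Q_mem (d : ℕ) : rX * rY ∈ genAlgebra d := coe_Q d ▸ gen_mem d (Sum.inl 1)
theorem e_mem (d : ℕ) : rx * rX + ry * rY ∈ genAlgebra d := coe_e d ▸ gen_mem d (Sum.inl 2)
theorem ratB_mem {d j : ℕ} (hj : j ≤ d) : ratB d rx ry rX rY j ∈ genAlgebra d :=
  coe_b d ⟨j, by omega⟩ ▸ gen_mem d (Sum.inr ⟨j, by omega⟩)

theorem swap_eq_of_mem {d : ℕ} {f : RatFun} (hf : f ∈ genAlgebra d) : swap f = f := by
  have h : genAlgebra d ≤ AlgHom.equalizer (swap : RatFun →ₐ[ℂ] RatFun) (AlgHom.id ℂ RatFun) := by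
    refine Algebra.adjoin_le ?_
    rintro _ ⟨i | j, rfl⟩
    · change swap _ = _
      fin_cases i
      · change swap (q d : RatFun) = (q d : RatFun)
        rw [coe_q, map_mul, swap_rx, swap_ry, mul_comm]
      · change swap (Q d : RatFun) = (Q d : RatFun)
        rw [coe_Q, map_mul, swap_rX, swap_rY, mul_comm]
      · change swap (e d : RatFun) = (e d : RatFun)
        rw [coe_e, map_add, map_mul, map_mul, swap_rX, swap_rY, swap_rx, swap_ry, add_comm]
    · change swap (b d j : RatFun) = (b d j : RatFun)
      rw [coe_b, map_ratB, swap_rX, swap_rY, swap_rx, swap_ry, ratB_swap]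
  exact h hf

theorem swap_delta : swap (rx * rX - ry * rY) = -(rx * rX - ry * rY) := by
  rw [map_sub, map_mul, map_mul, swap_rX, swap_rY, swap_rx, swap_ry, neg_sub]

/-- The algebra `B + δB`, where `B` is generated by `q, Q, e, b_0, …, b_d`; it is closed under
products because `δ ^ 2 = e ^ 2 - 4 q Q`. For `p, r ∈ B` the swap maps `p + δ r` to `p - δ r`. -/
def genAlgebraDelta (d : ℕ) : Subalgebra ℂ RatFun where
  carrier := {f | ∃ p ∈ genAlgebra d, ∃ r ∈ genAlgebra d, f = p + (rx * rX - ry * rY) * r}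
  mul_mem' := by
    rintro _ _ ⟨p, hp, r, hr, rfl⟩ ⟨p', hp', r', hr', rfl⟩
    refine ⟨p * p' + ((rx * rX + ry * rY) ^ 2 - 4 * ((rx * ry) * (rX * rY))) * (r * r'), ?_,
      p * r' + r * p', ?_, by ring⟩
    · refine add_mem (mul_mem hp hp') (mul_mem (sub_mem (pow_mem (e_mem d) 2)
        (mul_mem ?_ (mul_mem (q_mem d) (Q_mem d)))) (mul_mem hr hr'))
      exact_mod_cast (genAlgebra d).natCast_mem 4
    · exact add_mem (mul_mem hp hr') (mul_mem hr hp')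
  add_mem' := by
    rintro _ _ ⟨p, hp, r, hr, rfl⟩ ⟨p', hp', r', hr', rfl⟩
    exact ⟨p + p', add_mem hp hp', r + r', add_mem hr hr', by ring⟩
  algebraMap_mem' c := ⟨_, (genAlgebra d).algebraMap_mem c, 0, zero_mem _, by ring⟩

theorem mem_genAlgebraDelta {d : ℕ} {f p r : RatFun} (hp : p ∈ genAlgebra d)
    (hr : r ∈ genAlgebra d) (h : 2 * f = p + (rx * rX - ry * rY) * r) :
    f ∈ genAlgebraDelta d := by
  refine ⟨(2⁻¹ : ℂ) • p, Subalgebra.smul_mem _ hp _, (2⁻¹ : ℂ) • r,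
    Subalgebra.smul_mem _ hr _, ?_⟩
  rw [mul_smul_comm, ← smul_add, ← h, two_mul, ← two_smul ℂ f, smul_smul]
  norm_num

/-- The symmetric companions `x^(d-j) Y^j + y^(d-j) X^j` are `e b_j - 2 q b_(j+1)`, or
`2 Q b_(d-1) - e b_d` for `j = d`. -/
theorem pow_add_pow_mem {d j : ℕ} (hd : 1 ≤ d) (hj : j ≤ d) :
    rx ^ (d - j) * rY ^ j + ry ^ (d - j) * rX ^ j ∈ genAlgebra d := by
  have hδ := r_delta_ne_zero
  have h2 : (2 : RatFun) ∈ genAlgebra d := by exact_mod_cast (genAlgebra d).natCast_mem 2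
  rcases Nat.lt_or_ge j d with h | h
  · obtain ⟨m, rfl⟩ : ∃ m, d = m + j + 1 := ⟨d - 1 - j, by omega⟩
    convert! sub_mem (mul_mem (e_mem (m + j + 1)) (ratB_mem hj))
      (mul_mem h2 (mul_mem (q_mem _) (ratB_mem (j := j + 1) h))) using 1
    simp only [ratB, show m + j + 1 - j = m + 1 by omega, show m + j + 1 - (j + 1) = m by omega]
    field_simp
    ring
  · obtain rfl : j = d := le_antisymm hj h
    obtain ⟨m, rfl⟩ : ∃ m, j = m + 1 := ⟨j - 1, by omega⟩
    convert! sub_mem (mul_mem h2 (mul_mem (Q_mem _) (ratB_mem (Nat.le_succ m))))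
      (mul_mem (e_mem (m + 1)) (ratB_mem hj)) using 1
    simp only [ratB, show m + 1 - m = 1 by omega, Nat.sub_self]
    rw [mul_div_assoc', mul_div_assoc', mul_div_assoc', ← sub_div, eq_div_iff hδ]
    ring

theorem monomial_mem_genAlgebraDelta {d : ℕ} (hd : 1 ≤ d) (i j k l : ℕ)
    (h : i + l ≡ j + k [MOD d]) :
    rx ^ i * ry ^ j * rX ^ k * rY ^ l ∈ genAlgebraDelta d := by
  have hle : genAlgebra d ≤ genAlgebraDelta d :=
    fun f hf => ⟨f, hf, 0, zero_mem _, by ring⟩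
  refine monomial_mem _ (hle (q_mem d)) ?_ ?_ (hle (Q_mem d)) ?_ ?_ _ i j k l rfl h
  · exact mem_genAlgebraDelta (e_mem d) (one_mem _) (by ring)
  · exact mem_genAlgebraDelta (e_mem d) (neg_mem (one_mem _)) (by ring)
  · intro j hj
    refine mem_genAlgebraDelta (pow_add_pow_mem hd hj) (ratB_mem hj) ?_
    rw [ratB, mul_div_cancel₀ _ r_delta_ne_zero]
    ring
  · intro j hj
    refine mem_genAlgebraDelta (pow_add_pow_mem hd hj) (neg_mem (ratB_mem hj)) ?_
    rw [ratB, mul_neg, mul_div_cancel₀ _ r_delta_ne_zero]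
    ring

theorem monomial_eq_vars (m : Fin 2 ⊕ Fin 2 →₀ ℕ) (c : ℂ) :
    (monomial m c : Poly) = C c * (vx ^ m (.inl 0) * vy ^ m (.inl 1) * vX ^ m (.inr 0)
      * vY ^ m (.inr 1)) := by
  rw [monomial_eq, Finsupp.prod_fintype _ _ (by simp), Fintype.prod_sum_type]
  simp [Fin.prod_univ_two, vx, vy, vX, vY, mul_assoc]

theorem coeff_rotate (u : ℂˣ) (f : Poly) (m : Fin 2 ⊕ Fin 2 →₀ ℕ) :
    coeff m (act (refl u) (act (refl 1) f))
      = (u : ℂ) ^ (m (.inl 0) + m (.inr 1)) * ((u⁻¹ : ℂˣ) : ℂ) ^ (m (.inl 1) + m (.inr 0))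
        * coeff m f := by
  induction f using MvPolynomial.induction_on' with
  | add p r hp hr => simp only [map_add, coeff_add, hp, hr]; ring
  | monomial n c =>
    have h : act (refl u) (act (refl 1) (monomial n c)) = C ((u : ℂ) ^ (n (.inl 0) + n (.inr 1)) *
        ((u⁻¹ : ℂˣ) : ℂ) ^ (n (.inl 1) + n (.inr 0))) * monomial n c := by
      simp only [monomial_eq_vars, map_mul, map_pow, act_vx, act_vy, act_vX, act_vY]
      simp only [MvPolynomial.algHom_C, algebraMap_eq, inv_one, Units.val_one, map_one, one_mul]
      ring
    rw [h, coeff_C_mul, coeff_monomial]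
    split_ifs with hnm
    · rw [hnm]
    · simp

theorem mem_genAlgebraDelta_of_rotate {d : ℕ} (hd : 1 ≤ d) {u : ℂˣ}
    (hu : IsPrimitiveRoot (u : ℂ) d) {f : Poly} (hf : act (refl u) (act (refl 1) f) = f) :
    algebraMap Poly RatFun f ∈ genAlgebraDelta d := by
  rw [f.as_sum, map_sum]
  refine sum_mem fun m hm => ?_
  have hc : coeff m f ≠ 0 := mem_support_iff.1 hm
  have h := coeff_rotate u f m
  rw [hf] at h
  have hpow : (u : ℂ) ^ (m (.inl 0) + m (.inr 1)) = (u : ℂ) ^ (m (.inl 1) + m (.inr 0)) := by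
    have h1 := (mul_eq_right₀ hc).1 h.symm
    rwa [Units.val_inv_eq_inv_val, inv_pow, mul_inv_eq_one₀ (pow_ne_zero _ u.ne_zero)] at h1
  have hmod := pow_eq_pow_iff_modEq.1 (Units.ext (by simpa using hpow) :
    u ^ (m (.inl 0) + m (.inr 1)) = u ^ (m (.inl 1) + m (.inr 0)))
  rw [← (IsPrimitiveRoot.coe_units_iff.1 hu).eq_orderOf] at hmod
  rw [monomial_eq_vars, C_mul']
  have := Subalgebra.smul_mem _ (monomial_mem_genAlgebraDelta hd _ _ _ _ hmod) (coeff m f)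
  convert! this using 1
  exact (map_smul (IsScalarTower.toAlgHom ℂ Poly RatFun) _ _).trans (by simp [rx, ry, rX, rY])

theorem refl_mem_W {d : ℕ} {u : ℂˣ} (hu : u ^ d = 1) : refl u ∈ W d :=
  Subgroup.subset_closure ⟨u, hu, rfl⟩

theorem exists_unit_isPrimitiveRoot {d : ℕ} (hd : 1 ≤ d) :
    ∃ u : ℂˣ, IsPrimitiveRoot (u : ℂ) d ∧ u ^ d = 1 := by
  have h := Complex.isPrimitiveRoot_exp d (by omega)
  obtain ⟨u, hu⟩ := h.isUnit (by omega)
  rw [← hu] at h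
  exact ⟨u, h, Units.ext (by simpa using h.pow_eq_one)⟩

/-- The functions `q, Q, e, b_0, …, b_d` generate the algebra of `𝒴(d)`. By `coeff_rotate`, a
polynomial fixed by the rotations lies in `B + δB`; an invariant polynomial is also fixed by the
swap, hence lies in `B`, while `f ∈ I` is `δ g` with `g` changing sign under the swap, so that `g ∈
δB` and `f / δ ^ 2 ∈ B`. -/
theorem genAlgebra_eq_chartAlgebra {d : ℕ} (hd : 1 ≤ d) : genAlgebra d = chartAlgebra d := by
  have hδ := r_delta_ne_zero
  obtain ⟨u, hu, hud⟩ := exists_unit_isPrimitiveRoot hd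
  apply le_antisymm
  · exact Algebra.adjoin_le (by rintro _ ⟨i, rfl⟩; exact (gen d i).2)
  refine Algebra.adjoin_le ?_
  rintro _ (⟨f, rfl⟩ | ⟨f, hf, rfl⟩)
  · have h1 := f.2 _ (refl_mem_W (one_pow d))
    have hu := mem_genAlgebraDelta_of_rotate hd hu (f := f) (by rw [h1, f.2 _ (refl_mem_W hud)])
    obtain ⟨p, hp, r, hr, h⟩ := hu
    have hs := swap_algebraMap f
    rw [h1, h, map_add, map_mul, swap_delta, swap_eq_of_mem hp, swap_eq_of_mem hr] at hs
    have hr0 : (rx * rX - ry * rY) * r = 0 := by linear_combination (-hs / 2)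
    rw [h, hr0, add_zero]
    exact hp
  · obtain ⟨g, hg⟩ := Ideal.mem_span_singleton.1 (show (f : Poly) ∈ Ideal.span {delta} from hf)
    have key : ∀ u : ℂˣ, u ^ d = 1 → act (refl u) g = -g := by
      intro u hu
      have h := f.2 _ (refl_mem_W hu)
      rw [hg, map_mul, act_delta] at h
      apply mul_left_cancel₀ delta_ne_zero
      linear_combination -h
    have hu := mem_genAlgebraDelta_of_rotate hd hu (f := g)
      (by rw [key 1 (one_pow d), map_neg, key u hud, neg_neg])
    obtain ⟨p, hp, r, hr, h⟩ := hu
    have hs := swap_algebraMap g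
    rw [key 1 (one_pow d), map_neg, h, map_add, map_mul, swap_delta, swap_eq_of_mem hp,
      swap_eq_of_mem hr] at hs
    have hp0 : p = 0 := by linear_combination hs / 2
    rw [hg, map_mul, map_pow, h, hp0, algebraMap_delta]
    convert! hr using 1
    field_simp
    ring

/-! ### Shears -/

theorem ratB_shear {K : Type*} [Field K] (d j : ℕ) (ξ x y X Y : K) :
    ratB d (x + ξ * Y) (y + ξ * X) X Y j
      = ∑ k ∈ Finset.range (d - j + 1), ξ ^ k * (d - j).choose k * ratB d x y X Y (j + k) := by
  have hδ : (x + ξ * Y) * X - (y + ξ * X) * Y = x * X - y * Y := by ring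
  simp only [ratB, hδ, mul_div_assoc']
  rw [← Finset.sum_div]
  congr 1
  rw [add_comm x, add_comm y, add_pow, add_pow, Finset.sum_mul, Finset.sum_mul,
    ← Finset.sum_sub_distrib]
  refine Finset.sum_congr rfl fun k _ => ?_
  rw [← Nat.sub_sub]
  ring

/-- The automorphism `x ↦ x + ξ Y`, `y ↦ y + ξ X` of `Poly`, fixing `X`, `Y` and `δ`. It belongs to
the action of `SL₂` in which `(x, Y)` and `(y, X)` are vectors, and which commutes with `W_d`. -/
def shearHom (ξ : ℂ) : Poly →ₐ[ℂ] Poly :=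
  aeval (Sum.elim ![vx + C ξ * vY, vy + C ξ * vX] ![vX, vY])

theorem shearHom_vx (ξ : ℂ) : shearHom ξ vx = vx + C ξ * vY := by simp [shearHom, vx]
theorem shearHom_vy (ξ : ℂ) : shearHom ξ vy = vy + C ξ * vX := by simp [shearHom, vy]
theorem shearHom_vX (ξ : ℂ) : shearHom ξ vX = vX := by simp [shearHom, vX]
theorem shearHom_vY (ξ : ℂ) : shearHom ξ vY = vY := by simp [shearHom, vY]

theorem shearHom_comp (ξ η : ℂ) : (shearHom ξ).comp (shearHom η) = shearHom (ξ + η) := by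
  have hC : ∀ c, shearHom ξ (C c) = C c := fun c => AlgHom.commutes _ c
  apply MvPolynomial.algHom_ext
  rintro (i | i) <;> fin_cases i
  · change shearHom ξ (shearHom η vx) = shearHom (ξ + η) vx
    simp only [shearHom_vx, map_add, map_mul, shearHom_vY, hC]
    ring
  · change shearHom ξ (shearHom η vy) = shearHom (ξ + η) vy
    simp only [shearHom_vy, map_add, map_mul, shearHom_vX, hC]
    ring
  · change shearHom ξ (shearHom η vX) = shearHom (ξ + η) vX
    simp only [shearHom_vX]
  · change shearHom ξ (shearHom η vY) = shearHom (ξ + η) vY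
    simp only [shearHom_vY]

theorem shearHom_zero : shearHom 0 = AlgHom.id ℂ Poly := by
  apply MvPolynomial.algHom_ext
  rintro (i | i) <;> fin_cases i <;> simp [shearHom, vx, vy, vX, vY]

/-- The shear `x ↦ x + ξ Y`, `y ↦ y + ξ X` on rational functions. -/
def shearRat (ξ : ℂ) : RatFun ≃ₐ[ℂ] RatFun :=
  ratAut (AlgEquiv.ofAlgHom (shearHom ξ) (shearHom (-ξ))
    (by rw [shearHom_comp, add_neg_cancel, shearHom_zero])
    (by rw [shearHom_comp, neg_add_cancel, shearHom_zero]))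

theorem shearRat_algebraMap (ξ : ℂ) (f : Poly) :
    shearRat ξ (algebraMap Poly RatFun f) = algebraMap Poly RatFun (shearHom ξ f) :=
  ratAut_algebraMap _ f

theorem shearRat_add (ξ η : ℂ) (f : RatFun) :
    shearRat ξ (shearRat η f) = shearRat (ξ + η) f := by
  obtain ⟨g, h, -, rfl⟩ := IsFractionRing.div_surjective Poly f
  simp only [map_div₀, shearRat_algebraMap, ← shearHom_comp, AlgHom.comp_apply]

theorem shearRat_zero (f : RatFun) : shearRat 0 f = f := by
  obtain ⟨g, h, -, rfl⟩ := IsFractionRing.div_surjective Poly f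
  simp only [map_div₀, shearRat_algebraMap, shearHom_zero, AlgHom.id_apply]

theorem algebraMap_C_eq (ξ : ℂ) : algebraMap Poly RatFun (C ξ) = algebraMap ℂ RatFun ξ :=
  (IsScalarTower.algebraMap_apply ℂ Poly RatFun ξ).symm

theorem shearRat_rx (ξ : ℂ) : shearRat ξ rx = rx + algebraMap ℂ RatFun ξ * rY := by
  rw [rx, shearRat_algebraMap, shearHom_vx, map_add, map_mul, algebraMap_C_eq, rY]
theorem shearRat_ry (ξ : ℂ) : shearRat ξ ry = ry + algebraMap ℂ RatFun ξ * rX := by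
  rw [ry, shearRat_algebraMap, shearHom_vy, map_add, map_mul, algebraMap_C_eq, rX]
theorem shearRat_rX (ξ : ℂ) : shearRat ξ rX = rX := by
  rw [rX, shearRat_algebraMap, shearHom_vX]
theorem shearRat_rY (ξ : ℂ) : shearRat ξ rY = rY := by
  rw [rY, shearRat_algebraMap, shearHom_vY]

/-- The regular function `b_j` for `j ≤ d`, and `0` for `j > d`. -/
def bNat (d j : ℕ) : chartAlgebra d := if h : j < d + 1 then b d ⟨j, h⟩ else 0

theorem bNat_val (d : ℕ) (j : Fin (d + 1)) : bNat d j = b d j := dif_pos j.2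

theorem coe_bNat {d j : ℕ} (hj : j ≤ d) : (bNat d j : RatFun) = ratB d rx ry rX rY j := by
  rw [bNat, dif_pos (by omega), coe_b]

theorem shearRat_q (d : ℕ) (ξ : ℂ) :
    shearRat ξ (q d) = ((q d + ξ • e d + ξ ^ 2 • Q d : chartAlgebra d) : RatFun) := by
  push_cast
  rw [coe_q, coe_e, coe_Q, map_mul, shearRat_rx, shearRat_ry, Algebra.smul_def, Algebra.smul_def,
    map_pow]
  ring

theorem shearRat_Q (d : ℕ) (ξ : ℂ) : shearRat ξ (Q d) = (Q d : RatFun) := by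
  rw [coe_Q, map_mul, shearRat_rX, shearRat_rY]

theorem shearRat_e (d : ℕ) (ξ : ℂ) :
    shearRat ξ (e d) = ((e d + (2 * ξ) • Q d : chartAlgebra d) : RatFun) := by
  push_cast
  rw [coe_e, coe_Q, map_add, map_mul, map_mul, shearRat_rx, shearRat_ry, shearRat_rX, shearRat_rY,
    Algebra.smul_def, map_mul, map_ofNat]
  ring

theorem shearRat_bNat {d j : ℕ} (hj : j ≤ d) (ξ : ℂ) :
    shearRat ξ (bNat d j) = ((∑ k ∈ Finset.range (d - j + 1),
      (ξ ^ k * (d - j).choose k) • bNat d (j + k) : chartAlgebra d) : RatFun) := by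
  push_cast
  rw [coe_bNat hj, map_ratB, shearRat_rx, shearRat_ry, shearRat_rX, shearRat_rY, ratB_shear]
  refine Finset.sum_congr rfl fun k hk => ?_
  rw [coe_bNat (by rw [Finset.mem_range] at hk; omega), Algebra.smul_def]
  simp

theorem shearRat_mem {d : ℕ} (hd : 1 ≤ d) (ξ : ℂ) {f : RatFun} (hf : f ∈ chartAlgebra d) :
    shearRat ξ f ∈ chartAlgebra d := by
  have h : genAlgebra d ≤ (chartAlgebra d).comap (shearRat ξ : RatFun →ₐ[ℂ] RatFun) := by
    refine Algebra.adjoin_le ?_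
    rintro _ ⟨i | j, rfl⟩
    · fin_cases i
      · change shearRat ξ (q d) ∈ chartAlgebra d
        rw [shearRat_q]; exact SetLike.coe_mem _
      · change shearRat ξ (Q d) ∈ chartAlgebra d
        rw [shearRat_Q]; exact SetLike.coe_mem _
      · change shearRat ξ (e d) ∈ chartAlgebra d
        rw [shearRat_e]; exact SetLike.coe_mem _
    · change shearRat ξ (b d j) ∈ chartAlgebra d
      rw [← bNat_val, shearRat_bNat (by omega)]; exact SetLike.coe_mem _
  rw [genAlgebra_eq_chartAlgebra hd] at h
  exact h hf

/-- The shear `x ↦ x + ξ Y`, `y ↦ y + ξ X` on the algebra of regular functions of `𝒴(d)`. -/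
def shear {d : ℕ} (hd : 1 ≤ d) (ξ : ℂ) : chartAlgebra d →ₐ[ℂ] chartAlgebra d :=
  ((shearRat ξ : RatFun →ₐ[ℂ] RatFun).comp (chartAlgebra d).val).codRestrict (chartAlgebra d)
    fun f => shearRat_mem hd ξ f.2

section Shear
variable {d : ℕ} (hd : 1 ≤ d) (ξ : ℂ)

theorem shear_add (η : ℂ) (f : chartAlgebra d) :
    shear hd ξ (shear hd η f) = shear hd (ξ + η) f :=
  Subtype.ext (shearRat_add ξ η f)

theorem shear_zero (f : chartAlgebra d) : shear hd 0 f = f := Subtype.ext (shearRat_zero f)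

theorem shear_q : shear hd ξ (q d) = q d + ξ • e d + ξ ^ 2 • Q d := Subtype.ext (shearRat_q d ξ)

theorem shear_Q : shear hd ξ (Q d) = Q d := Subtype.ext (shearRat_Q d ξ)

theorem shear_e : shear hd ξ (e d) = e d + (2 * ξ) • Q d := Subtype.ext (shearRat_e d ξ)

theorem shear_bNat {j : ℕ} (hj : j ≤ d) : shear hd ξ (bNat d j) =
    ∑ k ∈ Finset.range (d - j + 1), (ξ ^ k * (d - j).choose k) • bNat d (j + k) :=
  Subtype.ext (shearRat_bNat hj ξ)

end Shear

/-! ### Relations between the generators -/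

theorem bNat_quadratic {d : ℕ} (hd : 1 ≤ d) : bNat d 0 ^ 2 * Q d
    = e d * bNat d 0 * bNat d 1 - q d * bNat d 1 ^ 2 + q d ^ (d - 1) := by
  apply Subtype.ext
  push_cast
  rw [coe_bNat (Nat.zero_le _), coe_bNat hd, coe_q, coe_e, coe_Q]
  exact ratB_quadratic hd r_delta_ne_zero

theorem bNat_succ {d j : ℕ} (hj : j < d) : bNat d 0 * bNat d (j + 1)
    = bNat d 1 * bNat d j - q d ^ (d - 1 - j) * lucas (e d) (q d * Q d) j := by
  apply Subtype.ext
  have h := map_lucas (chartAlgebra d).val (e d) (q d * Q d) j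
  simp only [Subalgebra.coe_val] at h
  push_cast
  rw [h, coe_bNat (Nat.zero_le _), coe_bNat (by omega), coe_bNat hj.le, coe_bNat (by omega)]
  push_cast
  rw [coe_q, coe_e, coe_Q]
  exact ratB_succ hj r_delta_ne_zero

/-! ### Points and coordinates -/

/-- The points of `ℂ^(d+4)` satisfying all polynomial relations between `q, Q, e, b_0, …, b_d`. -/
def relVariety (d : ℕ) : Set (Fin 3 ⊕ Fin (d + 1) → ℂ) :=
  {c | ∀ G : MvPolynomial (Fin 3 ⊕ Fin (d + 1)) ℂ, aeval (gen d) G = 0 → aeval c G = 0}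

theorem isClosed_relVariety (d : ℕ) : IsClosed (relVariety d) := by
  simp only [relVariety, Set.ofPred_forall]
  refine isClosed_iInter fun G => isClosed_iInter fun _ => isClosed_eq ?_ continuous_const
  exact MvPolynomial.continuous_eval G

theorem aeval_gen_surjective {d : ℕ} (hd : 1 ≤ d) :
    Function.Surjective (aeval (R := ℂ) (gen d)) := by
  intro f
  have hf : (f : RatFun) ∈ genAlgebra d := by
    rw [genAlgebra_eq_chartAlgebra hd]; exact f.2
  rw [genAlgebra, Algebra.adjoin_range_eq_range_aeval] at hf
  obtain ⟨G, hG⟩ := hf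
  refine ⟨G, Subtype.ext (Eq.trans ?_ hG)⟩
  exact (comp_aeval_apply (gen d) (chartAlgebra d).val G)

theorem point_ext {d : ℕ} (hd : 1 ≤ d) {φ ψ : chartAlgebra d →ₐ[ℂ] ℂ}
    (h : ∀ i, φ (gen d i) = ψ (gen d i)) : φ = ψ := by
  refine AlgHom.ext fun f => ?_
  obtain ⟨G, rfl⟩ := aeval_gen_surjective hd f
  rw [comp_aeval_apply, comp_aeval_apply]
  simp only [h]

/-- The point of `𝒴(d)` with given coordinates. -/
def pointOf {d : ℕ} (hd : 1 ≤ d) (c : relVariety d) : chartAlgebra d →ₐ[ℂ] ℂ :=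
  (Ideal.Quotient.liftₐ (RingHom.ker (aeval (R := ℂ) (gen d))) (aeval c.1)
    fun G hG => c.2 G hG).comp
    (Ideal.quotientKerAlgEquivOfSurjective (aeval_gen_surjective hd)).symm.toAlgHom

theorem pointOf_aeval {d : ℕ} (hd : 1 ≤ d) (c : relVariety d)
    (G : MvPolynomial (Fin 3 ⊕ Fin (d + 1)) ℂ) : pointOf hd c (aeval (gen d) G) = aeval c.1 G := by
  have h : (Ideal.quotientKerAlgEquivOfSurjective (aeval_gen_surjective hd)).symm
      (aeval (gen d) G) = Ideal.Quotient.mk _ G := by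
    rw [AlgEquiv.symm_apply_eq]; rfl
  simp only [pointOf, AlgHom.comp_apply]
  change Ideal.Quotient.liftₐ _ _ _ ((Ideal.quotientKerAlgEquivOfSurjective _).symm _) = _
  rw [h]; rfl

theorem pointOf_gen {d : ℕ} (hd : 1 ≤ d) (c : relVariety d) (i) :
    pointOf hd c (gen d i) = c.1 i := by
  simpa using pointOf_aeval hd c (X i)

theorem continuous_pointOf {d : ℕ} (hd : 1 ≤ d) {T : Type*} [TopologicalSpace T]
    {c : T → relVariety d} (hc : Continuous c) :
    Continuous fun t => (show Y d from pointOf hd (c t)) := by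
  refine continuous_induced_rng.2 (continuous_pi fun f => ?_)
  obtain ⟨G, rfl⟩ := aeval_gen_surjective hd f
  change Continuous fun t => pointOf hd (c t) (aeval (gen d) G)
  simp only [pointOf_aeval]
  exact (MvPolynomial.continuous_eval G).comp (continuous_subtype_val.comp hc)

/-- The point of `ℂ^(d+4)` with coordinates `q, Q, e` and `b_j = β j` for `j ≤ d`. -/
def tuple (d : ℕ) (q Q e : ℂ) (β : ℕ → ℂ) : Fin 3 ⊕ Fin (d + 1) → ℂ :=
  Sum.elim ![q, Q, e] fun j => β j

/-- A polynomial in `q, Q, e, b_0, …, b_d` becomes a polynomial in `x, y, X, Y` after multiplication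
by a power of `δ`, compatibly with evaluation at a point where `δ` does not vanish. -/
theorem exists_clear_denominator (d : ℕ) {x y X Y : ℂ} (h : x * X - y * Y ≠ 0)
    (G : MvPolynomial (Fin 3 ⊕ Fin (d + 1)) ℂ) :
    ∃ (N : ℕ) (F : Poly), algebraMap Poly RatFun F
        = algebraMap Poly RatFun delta ^ N * aeval (fun i => (gen d i : RatFun)) G ∧
      aeval (Sum.elim ![x, y] ![X, Y]) F = (x * X - y * Y) ^ N *
        aeval (tuple d (x * y) (X * Y) (x * X + y * Y) (ratB d x y X Y)) G := by
  have hx : aeval (Sum.elim ![x, y] ![X, Y]) vx = x := by simp [vx]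
  have hy : aeval (Sum.elim ![x, y] ![X, Y]) vy = y := by simp [vy]
  have hX : aeval (Sum.elim ![x, y] ![X, Y]) vX = X := by simp [vX]
  have hY : aeval (Sum.elim ![x, y] ![X, Y]) vY = Y := by simp [vY]
  have hδ : aeval (Sum.elim ![x, y] ![X, Y]) delta = x * X - y * Y := by
    simp only [delta, map_sub, map_mul, hx, hy, hX, hY]
  induction G using MvPolynomial.induction_on with
  | C a => exact ⟨0, C a, by simp [algebraMap_C_eq], by simp⟩
  | add G₁ G₂ h₁ h₂ =>
    obtain ⟨N₁, F₁, h₁, h₁'⟩ := h₁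
    obtain ⟨N₂, F₂, h₂, h₂'⟩ := h₂
    refine ⟨N₁ + N₂, delta ^ N₂ * F₁ + delta ^ N₁ * F₂, ?_, ?_⟩
    · simp only [map_add, map_mul, map_pow, h₁, h₂]; ring
    · simp only [map_add, map_mul, map_pow, h₁', h₂', hδ]; ring
  | mul_X G i h₁ =>
    obtain ⟨N, F, h₁, h₁'⟩ := h₁
    have key : ∃ F' : Poly, algebraMap Poly RatFun F' = algebraMap Poly RatFun delta * gen d i ∧
        aeval (Sum.elim ![x, y] ![X, Y]) F' = (x * X - y * Y) *
          tuple d (x * y) (X * Y) (x * X + y * Y) (ratB d x y X Y) i := by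
      rcases i with i | j
      · fin_cases i
        · refine ⟨delta * (vx * vy), map_mul _ _ _, ?_⟩
          simp only [map_mul, hδ, hx, hy]; rfl
        · refine ⟨delta * (vX * vY), map_mul _ _ _, ?_⟩
          simp only [map_mul, hδ, hX, hY]; rfl
        · refine ⟨delta * (vx * vX + vy * vY), map_mul _ _ _, ?_⟩
          simp only [map_mul, map_add, hδ, hX, hY, hx, hy]; rfl
      · refine ⟨beta d j, (mul_div_cancel₀ _ algebraMap_delta_ne_zero).symm, ?_⟩
        simp only [beta, map_sub, map_mul, map_pow, hX, hY, hx, hy]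
        exact (mul_div_cancel₀ _ h).symm
    obtain ⟨F', h₂, h₂'⟩ := key
    refine ⟨N + 1, F * F', ?_, ?_⟩
    · simp only [map_mul, h₁, h₂, aeval_X]; ring
    · simp only [map_mul, h₁', h₂', aeval_X]; ring

theorem tuple_mem_of_delta_ne_zero (d : ℕ) {x y X Y : ℂ} (h : x * X - y * Y ≠ 0) :
    tuple d (x * y) (X * Y) (x * X + y * Y) (ratB d x y X Y) ∈ relVariety d := by
  intro G hG
  obtain ⟨N, F, h₁, h₂⟩ := exists_clear_denominator d h G
  have h0 : aeval (fun i => (gen d i : RatFun)) G = 0 := by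
    have := comp_aeval_apply (gen d) (chartAlgebra d).val G
    rw [hG, map_zero] at this
    exact this.symm
  rw [h0, mul_zero] at h₁
  obtain rfl : F = 0 := IsFractionRing.injective Poly RatFun (h₁.trans (map_zero _).symm)
  rw [map_zero] at h₂
  exact (mul_eq_zero.1 h₂.symm).resolve_left (pow_ne_zero _ h)

theorem tuple_congr {d : ℕ} {q Q Q' e : ℂ} {β β' : ℕ → ℂ} (hQ : Q = Q')
    (hβ : ∀ j ≤ d, β j = β' j) : tuple d q Q e β = tuple d q Q' e β' := by
  subst hQ
  funext i
  rcases i with i | j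
  · rfl
  · exact hβ j (by omega)

/-! ### The affine chart and the disc -/

/-- The coordinates of the point of the locus `b₀ ≠ 0` with given `q, e, b₁, b₀`. -/
def chartTuple (d : ℕ) (q e b₁ b₀ : ℂ) : Fin 3 ⊕ Fin (d + 1) → ℂ :=
  tuple d q (chartQ d q e b₁ b₀) e (chartB d q e b₁ b₀)

theorem continuous_lucas {T : Type*} [TopologicalSpace T] {e w : T → ℂ} (he : Continuous e)
    (hw : Continuous w) (n : ℕ) : Continuous fun t => lucas (e t) (w t) n := by
  induction n using Nat.twoStepInduction with
  | zero => exact continuous_const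
  | one => exact continuous_const
  | more n h0 h1 => exact (he.mul h1).sub (hw.mul h0)

theorem continuous_tuple {T : Type*} [TopologicalSpace T] {d : ℕ} {q Q e : T → ℂ} {β : T → ℕ → ℂ}
    (hq : Continuous q) (hQ : Continuous Q) (he : Continuous e)
    (hβ : ∀ j, Continuous fun t => β t j) :
    Continuous fun t => tuple d (q t) (Q t) (e t) (β t) := by
  refine continuous_pi ?_
  rintro (i | j)
  · fin_cases i
    · exact hq
    · exact hQ
    · exact he
  · exact hβ j

theorem continuous_chartTuple {T : Type*} [TopologicalSpace T] (d : ℕ) {q e b₁ b₀ : T → ℂ}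
    (hq : Continuous q) (he : Continuous e) (h₁ : Continuous b₁) (h₀ : Continuous b₀)
    (hne : ∀ t, b₀ t ≠ 0) : Continuous fun t => chartTuple d (q t) (e t) (b₁ t) (b₀ t) := by
  have hQ : Continuous fun t => chartQ d (q t) (e t) (b₁ t) (b₀ t) := by
    unfold chartQ
    exact Continuous.div (by fun_prop) (by fun_prop) fun t => pow_ne_zero _ (hne t)
  refine continuous_tuple hq hQ he fun j => ?_
  induction j with
  | zero => exact h₀
  | succ j ih =>
    have hl := continuous_lucas he (hq.mul hQ) j
    exact Continuous.div (by fun_prop) h₀ hne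

/-- All values of `q, e, b₁` and of `b₀ ≠ 0` occur on `𝒴(d)`: a dense set of them comes from points
of `ℂ⁴` with `δ ≠ 0`, and the relations define a closed set. -/
theorem chartTuple_mem {d : ℕ} (hd : 2 ≤ d) (q e b₁ : ℂ) {b₀ : ℂ} (h0 : b₀ ≠ 0) :
    chartTuple d q e b₁ b₀ ∈ relVariety d := by
  have hc : IsClosed {e | chartTuple d q e b₁ b₀ ∈ relVariety d} :=
    (isClosed_relVariety d).preimage (continuous_chartTuple d continuous_const continuous_id
      continuous_const continuous_const fun _ => h0)
  have hsub : {e : ℂ | (e * b₀ - 2 * q * b₁) ^ 2 ≠ 4 * q ^ d} ⊆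
      {e | chartTuple d q e b₁ b₀ ∈ relVariety d} := by
    intro e he
    obtain ⟨x, y, X, Y, hδ, rfl, rfl, rfl, rfl⟩ := exists_point_of_chart hd h0 he
    have h := tuple_mem_of_delta_ne_zero d hδ
    obtain ⟨hQ, hB⟩ := eq_chartB h0 (ratB_quadratic (by omega) hδ) fun j hj => ratB_succ hj hδ
    rw [tuple_congr hQ hB] at h
    exact h
  have := ((dense_discriminant_ne d q b₁ h0).mono hsub).closure_eq
  rw [hc.closure_eq] at this
  exact this.ge (Set.mem_univ e)

/-- The coordinates `q = Q = 1`, `e = 2`, `b_j = z - j` of a curve in `𝒴(d)`. -/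
def discTuple (d : ℕ) (z : ℂ) : Fin 3 ⊕ Fin (d + 1) → ℂ := tuple d 1 1 2 fun j => z - j

theorem continuous_discTuple (d : ℕ) : Continuous (discTuple d) :=
  continuous_tuple continuous_const continuous_const continuous_const fun j => by fun_prop

theorem discTuple_eq (d : ℕ) {z : ℂ} (hz : z ≠ 0) :
    discTuple d z = chartTuple d 1 2 (z - 1) z := by
  rw [chartTuple, (chart_disc hz).1, discTuple]
  congr 1
  funext j
  exact ((chart_disc hz).2 j).symm

theorem discTuple_mem {d : ℕ} (hd : 2 ≤ d) (z : ℂ) : discTuple d z ∈ relVariety d := by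
  have hc : IsClosed {z | discTuple d z ∈ relVariety d} :=
    (isClosed_relVariety d).preimage (continuous_discTuple d)
  have hsub : ({0}ᶜ : Set ℂ) ⊆ {z | discTuple d z ∈ relVariety d} := by
    intro z hz
    change discTuple d z ∈ relVariety d
    rw [discTuple_eq d hz]
    exact chartTuple_mem hd _ _ _ hz
  have := ((dense_compl_singleton (0 : ℂ)).mono hsub).closure_eq
  rw [hc.closure_eq] at this
  exact this.ge (Set.mem_univ z)

end Algebra

/-! ### The cover by charts -/

/-- A point of `𝒴(d)` as a homomorphism of algebras. -/
def Y.hom {d : ℕ} (P : Y d) : chartAlgebra d →ₐ[ℂ] ℂ := P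

/-- The homomorphism `pointOf`, as an element of the topological space `Y d`. -/
def Y.ofCoords {d : ℕ} (hd : 1 ≤ d) (c : relVariety d) : Y d := pointOf hd c

theorem Y.ofCoords_gen {d : ℕ} (hd : 1 ≤ d) (c : relVariety d) (i) :
    (Y.ofCoords hd c).hom (gen d i) = c.1 i := pointOf_gen hd c i

theorem Y.continuous_hom {d : ℕ} (f : chartAlgebra d) : Continuous fun P : Y d => P.hom f :=
  (continuous_apply f).comp continuous_induced_dom

theorem Y.ext_gen {d : ℕ} (hd : 1 ≤ d) {P P' : Y d} (h : ∀ i, P.hom (gen d i) = P'.hom (gen d i)) :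
    P = P' := point_ext hd h

theorem Y.hom_shear_bNat_zero {d : ℕ} (hd : 1 ≤ d) (P : Y d) (ξ : ℂ) : P.hom (shear hd ξ (bNat d 0))
    = ∑ k ∈ Finset.range (d + 1), ξ ^ k * d.choose k * P.hom (bNat d k) := by
  rw [shear_bNat hd ξ (Nat.zero_le d), map_sum, Nat.sub_zero]
  simp only [map_smul, smul_eq_mul, zero_add]

/-- The shears of the locus `b₀ ≠ 0` cover `𝒴(d) ∖ {0}`. The value at `P` of the shear of `b₀` is a
polynomial in `ξ` with coefficients proportional to the `b_j(P)`; if it is zero, all `b_j` vanish at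
`P`, and then the quadratic relation, applied to shears of `P`, shows that `q, Q, e` vanish too. -/
theorem mem_puncturedY_iff {d : ℕ} (hd : 2 ≤ d) (P : Y d) :
    P ∈ puncturedY d ↔ ∃ ξ, P.hom (shear (by omega) ξ (bNat d 0)) ≠ 0 := by
  have hd1 : 1 ≤ d := by omega
  rw [← not_iff_not]
  push Not
  have hP : P ∉ puncturedY d ↔ coords P = 0 := not_not
  rw [hP]
  constructor
  · intro h ξ
    rw [Y.hom_shear_bNat_zero]
    refine Finset.sum_eq_zero fun k hk => ?_
    have hb := congrFun (congrArg (fun c => c.2.2.2) h) ⟨k, Finset.mem_range.1 hk⟩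
    have hb' : P.hom (bNat d k) = 0 := by rw [bNat, dif_pos (Finset.mem_range.1 hk)]; exact hb
    rw [hb', mul_zero]
  · intro h
    have hb : ∀ k ≤ d, P.hom (bNat d k) = 0 := by
      intro k hk
      set p : Polynomial ℂ := ∑ k ∈ Finset.range (d + 1),
        Polynomial.C (d.choose k * P.hom (bNat d k)) * Polynomial.X ^ k with hp
      have hp0 : p = 0 := by
        refine Polynomial.funext fun ξ => ?_
        have := h ξ
        rw [Y.hom_shear_bNat_zero] at this
        rw [hp, Polynomial.eval_finsetSum, Polynomial.eval_zero, ← this]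
        refine Finset.sum_congr rfl fun k _ => ?_
        simp only [Polynomial.eval_mul, Polynomial.eval_C, Polynomial.eval_pow, Polynomial.eval_X]
        ring
      have hc := congrArg (fun r => Polynomial.coeff r k) hp0
      simp only [hp, Polynomial.finsetSum_coeff, Polynomial.coeff_C_mul_X_pow,
        Polynomial.coeff_zero, Finset.sum_ite_eq, Finset.mem_range, Nat.lt_succ_of_le hk, if_true,
        mul_eq_zero, Nat.cast_eq_zero] at hc
      exact hc.resolve_left (Nat.choose_pos hk).ne'
    have hq : ∀ ξ : ℂ, P.hom (q d) + ξ * P.hom (e d) + ξ ^ 2 * P.hom (Q d) = 0 := by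
      intro ξ
      have hs : ∀ j ≤ d, P.hom (shear hd1 ξ (bNat d j)) = 0 := by
        intro j hj
        rw [shear_bNat hd1 ξ hj, map_sum]
        refine Finset.sum_eq_zero fun k hk => ?_
        rw [map_smul, hb _ (by rw [Finset.mem_range] at hk; omega), smul_zero]
      have hr := congrArg (fun f => P.hom (shear hd1 ξ f)) (bNat_quadratic hd1)
      simp only [map_mul, map_add, map_sub, map_pow, hs 0 (Nat.zero_le _), hs 1 hd1] at hr
      have h0 : P.hom (shear hd1 ξ (q d)) ^ (d - 1) = 0 := by
        rw [← sub_eq_zero]; linear_combination -hr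
      have h1 := pow_eq_zero_iff (by omega) |>.1 h0
      rw [shear_q] at h1
      simpa using h1
    have h0 := hq 0
    have h1 := hq 1
    have h2 := hq (-1)
    have hq0 : P.hom (q d) = 0 := by linear_combination h0
    have he0 : P.hom (e d) = 0 := by linear_combination (h1 - h2) / 2
    have hQ0 : P.hom (Q d) = 0 := by linear_combination (h1 + h2) / 2 - h0
    refine Prod.ext hq0 (Prod.ext hQ0 (Prod.ext he0 (funext fun j => ?_)))
    have := hb j (by omega)
    rw [bNat_val] at this
    exact this

/-- The shear as a self-map of `𝒴(d)`. -/
def shearY {d : ℕ} (hd : 1 ≤ d) (ξ : ℂ) (P : Y d) : Y d := P.hom.comp (shear hd ξ)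

theorem hom_shearY {d : ℕ} (hd : 1 ≤ d) (ξ : ℂ) (P : Y d) (f : chartAlgebra d) :
    (shearY hd ξ P).hom f = P.hom (shear hd ξ f) := rfl

theorem continuous_shearY {d : ℕ} (hd : 1 ≤ d) (ξ : ℂ) : Continuous (shearY hd ξ) :=
  continuous_induced_rng.2 (continuous_pi fun f => Y.continuous_hom (shear hd ξ f))

/-! ### Charts of the punctured variety -/

section Punctured
variable {d : ℕ} (hd : 2 ≤ d)

/-- The shear as a self-map of `𝒴(d) ∖ {0}`. -/
def shearMap (ξ : ℂ) (P : puncturedY d) : puncturedY d :=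
  ⟨shearY (one_le_two.trans hd) ξ P.1, by
    obtain ⟨η, hη⟩ := (mem_puncturedY_iff hd P.1).1 P.2
    refine (mem_puncturedY_iff hd _).2 ⟨-ξ + η, ?_⟩
    rwa [hom_shearY, shear_add, add_neg_cancel_left]⟩

theorem hom_shearMap (ξ : ℂ) (P : puncturedY d) (f : chartAlgebra d) :
    (shearMap hd ξ P).1.hom f = P.1.hom (shear (one_le_two.trans hd) ξ f) := rfl

theorem continuous_shearMap (ξ : ℂ) : Continuous (shearMap hd ξ) :=
  ((continuous_shearY _ ξ).comp continuous_subtype_val).subtype_mk _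

theorem shearMap_neg_shearMap (ξ : ℂ) (P : puncturedY d) :
    shearMap hd (-ξ) (shearMap hd ξ P) = P := by
  refine Subtype.ext (Y.ext_gen (one_le_two.trans hd) fun i => ?_)
  rw [hom_shearMap, hom_shearMap, shear_add, add_neg_cancel, shear_zero]

/-- The open subset of `𝒴(d) ∖ {0}` where the shear of `b₀` by `ξ` does not vanish. -/
def chartSet (ξ : ℂ) : Set (puncturedY d) :=
  {P | P.1.hom (shear (one_le_two.trans hd) ξ (bNat d 0)) ≠ 0}

theorem isOpen_chartSet (ξ : ℂ) : IsOpen (chartSet hd ξ) :=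
  isOpen_ne.preimage ((Y.continuous_hom _).comp continuous_subtype_val)

/-- The map `(q, e, b₁, w) ↦ (q, e, b₁, b₀ = exp w)` from `ℂ⁴` to `𝒴(d) ∖ {0}`: the universal cover
of the locus `b₀ ≠ 0`. -/
def chartMap (p : ℂ × ℂ × ℂ × ℂ) : puncturedY d :=
  ⟨Y.ofCoords (one_le_two.trans hd) ⟨chartTuple d p.1 p.2.1 p.2.2.1 (Complex.exp p.2.2.2),
      chartTuple_mem hd _ _ _ (Complex.exp_ne_zero _)⟩, by
    refine (mem_puncturedY_iff hd _).2 ⟨0, ?_⟩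
    rw [shear_zero, show bNat d 0 = gen d (Sum.inr 0) from bNat_val d 0, Y.ofCoords_gen]
    exact Complex.exp_ne_zero p.2.2.2⟩

theorem chartMap_gen (p : ℂ × ℂ × ℂ × ℂ) (i) : (chartMap hd p).1.hom (gen d i)
    = chartTuple d p.1 p.2.1 p.2.2.1 (Complex.exp p.2.2.2) i :=
  Y.ofCoords_gen (one_le_two.trans hd) _ i

theorem chartMap_bNat (p : ℂ × ℂ × ℂ × ℂ) {j : ℕ} (hj : j ≤ d) : (chartMap hd p).1.hom (bNat d j)
    = chartB d p.1 p.2.1 p.2.2.1 (Complex.exp p.2.2.2) j := by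
  rw [bNat, dif_pos (Nat.lt_succ_of_le hj)]
  exact chartMap_gen hd p (Sum.inr ⟨j, Nat.lt_succ_of_le hj⟩)

theorem continuous_chartMap : Continuous (chartMap hd) := by
  refine Continuous.subtype_mk (continuous_pointOf _ (Continuous.subtype_mk ?_ _)) _
  exact continuous_chartTuple d (by fun_prop) (by fun_prop) (by fun_prop) (by fun_prop)
    fun _ => Complex.exp_ne_zero _

theorem chartMap_eq {P : puncturedY d} {w : ℂ} (hw : Complex.exp w = P.1.hom (bNat d 0)) :
    chartMap hd (P.1.hom (q d), P.1.hom (e d), P.1.hom (bNat d 1), w) = P := by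
  have hd1 := one_le_two.trans hd
  refine Subtype.ext (Y.ext_gen hd1 fun i => ?_)
  rw [chartMap_gen]
  dsimp only
  have h0 : P.1.hom (bNat d 0) ≠ 0 := hw ▸ Complex.exp_ne_zero w
  obtain ⟨hQ, hB⟩ := eq_chartB (d := d) (q := P.1.hom (q d)) (Q := P.1.hom (Q d))
    (e := P.1.hom (e d)) (β := fun j => P.1.hom (bNat d j)) h0
    (by simpa using congrArg P.1.hom (bNat_quadratic hd1))
    (fun j hj => by simpa [map_lucas] using congrArg P.1.hom (bNat_succ hj))
  rw [hw]
  rcases i with i | j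
  · fin_cases i
    · rfl
    · exact hQ.symm
    · rfl
  · refine (hB j (by omega)).symm.trans ?_
    rw [bNat_val]; rfl

/-- The curve `q = Q = 1`, `e = 2`, `b_j = z - j` in `𝒴(d) ∖ {0}`. It meets `b₀ = 0` only for `z =
0`. -/
def discMap (z : ℂ) : puncturedY d :=
  ⟨Y.ofCoords (one_le_two.trans hd) ⟨discTuple d z, discTuple_mem hd z⟩, fun h => one_ne_zero
    ((Y.ofCoords_gen (one_le_two.trans hd) ⟨discTuple d z, discTuple_mem hd z⟩ (Sum.inl 0)).symm
      |>.trans (congrArg Prod.fst h))⟩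

theorem discMap_gen (z : ℂ) (i) : (discMap hd z).1.hom (gen d i) = discTuple d z i :=
  Y.ofCoords_gen (one_le_two.trans hd) _ i

theorem continuous_discMap : Continuous (discMap hd) :=
  Continuous.subtype_mk (continuous_pointOf _ (Continuous.subtype_mk (continuous_discTuple d) _)) _

theorem chartMap_disc (w : ℂ) :
    chartMap hd (1, 2, Complex.exp w - 1, w) = discMap hd (Complex.exp w) := by
  refine Subtype.ext (Y.ext_gen (one_le_two.trans hd) fun i => ?_)
  rw [chartMap_gen, discMap_gen, discTuple_eq d (Complex.exp_ne_zero w)]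

theorem chartMap_add_period (p : ℂ × ℂ × ℂ × ℂ) (n : ℤ) :
    chartMap hd (p + (0, 0, 0, n * (2 * Real.pi * Complex.I))) = chartMap hd p := by
  refine Subtype.ext (Y.ext_gen (one_le_two.trans hd) fun i => ?_)
  rw [chartMap_gen, chartMap_gen]
  simp only [Prod.fst_add, Prod.snd_add, add_zero,
    Complex.exp_periodic.int_mul n p.2.2.2]

/-- The universal cover of the set `chartSet hd ξ`, obtained from `chartMap` by a shear. -/
def chartMapAt (ξ : ℂ) (p : ℂ × ℂ × ℂ × ℂ) : puncturedY d := shearMap hd (-ξ) (chartMap hd p)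

theorem continuous_chartMapAt (ξ : ℂ) : Continuous (chartMapAt hd ξ) :=
  (continuous_shearMap hd _).comp (continuous_chartMap hd)

theorem chartMapAt_hom_shear (ξ η : ℂ) (p : ℂ × ℂ × ℂ × ℂ) :
    (chartMapAt hd ξ p).1.hom (shear (one_le_two.trans hd) η (bNat d 0))
      = ∑ k ∈ Finset.range (d + 1), (-ξ + η) ^ k * d.choose k *
        chartB d p.1 p.2.1 p.2.2.1 (Complex.exp p.2.2.2) k := by
  rw [chartMapAt, hom_shearMap, shear_add, Y.hom_shear_bNat_zero]
  refine Finset.sum_congr rfl fun k hk => ?_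
  rw [chartMap_bNat hd p (Nat.lt_succ_iff.1 (Finset.mem_range.1 hk))]

theorem chartMapAt_mem_chartSet (ξ : ℂ) (p : ℂ × ℂ × ℂ × ℂ) :
    chartMapAt hd ξ p ∈ chartSet hd ξ := by
  change (chartMap hd p).1.hom (shear (one_le_two.trans hd) (-ξ)
    (shear (one_le_two.trans hd) ξ (bNat d 0))) ≠ 0
  rw [shear_add, neg_add_cancel, shear_zero, chartMap_bNat hd p (Nat.zero_le d)]
  exact Complex.exp_ne_zero _

theorem chartMapAt_eq {P : puncturedY d} {ξ w : ℂ}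
    (hw : Complex.exp w = P.1.hom (shear (one_le_two.trans hd) ξ (bNat d 0))) :
    chartMapAt hd ξ ((shearMap hd ξ P).1.hom (q d), (shearMap hd ξ P).1.hom (e d),
      (shearMap hd ξ P).1.hom (bNat d 1), w) = P := by
  rw [chartMapAt, chartMap_eq hd (P := shearMap hd ξ P) hw, shearMap_neg_shearMap]

end Punctured

/-! ### Intersections and fundamental groups of the charts -/

section Homotopy
variable {k : ℕ} (hd : 2 ≤ k + 2)

theorem chartTuple_origin (hk : k ≠ 0) (b₀ : ℂ) : chartTuple (k + 2) 0 0 0 b₀ =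
    tuple (k + 2) 0 0 0 (fun j => if j = 0 then b₀ else 0) := by
  refine tuple_congr (by simp [chartQ]) fun j hj => ?_
  rcases j with _ | j
  · rfl
  · simpa using chartB_origin k hk b₀ j (by omega)

theorem chartMapAt_zero_hom_shear (hk : k ≠ 0) (ξ η w : ℂ) :
    (chartMapAt hd ξ (0, 0, 0, w)).1.hom (shear (one_le_two.trans hd) η (bNat (k + 2) 0))
      = Complex.exp w := by
  rw [chartMapAt_hom_shear, Finset.sum_eq_single 0]
  · simp [chartB]
  · intro j hj hj0
    obtain ⟨i, rfl⟩ := Nat.exists_eq_succ_of_ne_zero hj0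
    rw [Finset.mem_range] at hj
    rw [chartB_origin k hk _ i (by omega), mul_zero]
  · simp

/-- The base point `q = e = b₁ = 0`, `b₀ = 1` is fixed by all shears, so it lies in every chart. -/
theorem shearMap_base (hk : k ≠ 0) (ξ : ℂ) :
    shearMap hd ξ (chartMap hd (0, 0, 0, 0)) = chartMap hd (0, 0, 0, 0) := by
  have hb : ∀ j ≤ k + 2, (chartMap hd (0, 0, 0, 0)).1.hom (bNat (k + 2) j) =
      if j = 0 then 1 else 0 := by
    intro j hj
    rw [chartMap_bNat hd _ hj]
    rcases j with _ | j
    · simp [chartB]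
    · simpa using chartB_origin k hk (Complex.exp 0) j (by omega)
  have hg : ∀ i, (chartMap hd (0, 0, 0, 0)).1.hom (gen (k + 2) i) = _ := fun i =>
    (chartMap_gen hd _ i).trans (congrFun (chartTuple_origin hk _) i)
  have hq : (chartMap hd (0, 0, 0, 0)).1.hom (q (k + 2)) = 0 := hg (Sum.inl 0)
  have hQ : (chartMap hd (0, 0, 0, 0)).1.hom (Q (k + 2)) = 0 := hg (Sum.inl 1)
  have he : (chartMap hd (0, 0, 0, 0)).1.hom (e (k + 2)) = 0 := hg (Sum.inl 2)
  refine Subtype.ext (Y.ext_gen (one_le_two.trans hd) fun i => ?_)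
  rw [hom_shearMap]
  rcases i with i | j
  · fin_cases i
    · change (chartMap hd (0, 0, 0, 0)).1.hom (shear _ ξ (q (k + 2))) =
        (chartMap hd (0, 0, 0, 0)).1.hom (q (k + 2))
      simp [shear_q, hq, hQ, he]
    · change (chartMap hd (0, 0, 0, 0)).1.hom (shear _ ξ (Q (k + 2))) =
        (chartMap hd (0, 0, 0, 0)).1.hom (Q (k + 2))
      rw [shear_Q]
    · change (chartMap hd (0, 0, 0, 0)).1.hom (shear _ ξ (e (k + 2))) =
        (chartMap hd (0, 0, 0, 0)).1.hom (e (k + 2))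
      simp [shear_e, hQ, he]
  · change (chartMap hd (0, 0, 0, 0)).1.hom (shear _ ξ (b (k + 2) j)) =
        (chartMap hd (0, 0, 0, 0)).1.hom (b (k + 2) j)
    rw [← bNat_val, shear_bNat _ ξ (by omega), map_sum, Finset.sum_eq_single 0]
    · simp
    · intro i hi hi0
      rw [Finset.mem_range] at hi
      rw [map_smul, hb _ (by omega), if_neg (by omega), smul_zero]
    · simp

theorem chartMapAt_zero (hk : k ≠ 0) (ξ : ℂ) :
    chartMapAt hd ξ (0, 0, 0, 0) = chartMap hd (0, 0, 0, 0) :=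
  shearMap_base hd hk (-ξ)

/-- Two charts meet in a path-connected set. A point is contracted to `q = e = b₁ = 0` by the
weighted scaling of `chartB_scale`. The condition to stay in the second chart is the nonvanishing of
a polynomial in the scaling parameter `l ∈ ℂ`, and the complement of its finitely many roots is
path-connected. -/
theorem joinedIn_chartSet (hk : k ≠ 0) {ξ η : ℂ} {P : puncturedY (k + 2)}
    (hξ : P ∈ chartSet hd ξ) (hη : P ∈ chartSet hd η) :
    JoinedIn (chartSet hd ξ ∩ chartSet hd η) (chartMap hd (0, 0, 0, 0)) P := by
  obtain ⟨w, hw⟩ : ∃ w, Complex.exp w = P.1.hom (shear (one_le_two.trans hd) ξ (bNat (k + 2) 0)) :=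
    ⟨_, Complex.exp_log hξ⟩
  obtain ⟨q, e, b₁, rfl⟩ : ∃ q e b₁, chartMapAt hd ξ (q, e, b₁, w) = P :=
    ⟨_, _, _, chartMapAt_eq hd hw⟩
  -- Along `q = e = b₁ = 0` all shears of `b₀` are equal to `b₀`.
  have h1 : JoinedIn (chartSet hd ξ ∩ chartSet hd η) (chartMap hd (0, 0, 0, 0))
      (chartMapAt hd ξ (0, 0, 0, w)) := by
    refine ⟨⟨⟨fun t => chartMapAt hd ξ (0, 0, 0, (t : ℝ) * w), ?_⟩, ?_, ?_⟩, fun t => ?_⟩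
    · exact (continuous_chartMapAt hd ξ).comp (by fun_prop)
    · simp [chartMapAt_zero hd hk]
    · simp
    · refine ⟨chartMapAt_mem_chartSet hd ξ _, ?_⟩
      change (chartMapAt hd ξ _).1.hom _ ≠ 0
      rw [chartMapAt_zero_hom_shear hd hk]
      exact Complex.exp_ne_zero _
  refine h1.trans ?_
  set c : ℂ → ℂ × ℂ × ℂ × ℂ := fun l => (l ^ 2 * q, l ^ (k + 2) * e, l ^ k * b₁, w) with hc
  set p : Polynomial ℂ := ∑ j ∈ Finset.range (k + 2 + 1), Polynomial.C ((-ξ + η) ^ j *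
    (k + 2).choose j * chartB (k + 2) q e b₁ (Complex.exp w) j) * Polynomial.X ^ (k * j) with hp
  have hpe : ∀ l, (chartMapAt hd ξ (c l)).1.hom (shear (one_le_two.trans hd) η (bNat (k + 2) 0))
      = p.eval l := by
    intro l
    rw [chartMapAt_hom_shear, hp, Polynomial.eval_finsetSum]
    refine Finset.sum_congr rfl fun j hj => ?_
    rw [hc]
    dsimp only
    rw [chartB_scale k q e b₁ _ l j (Nat.lt_succ_iff.1 (Finset.mem_range.1 hj))]
    simp only [Polynomial.eval_mul, Polynomial.eval_C, Polynomial.eval_pow, Polynomial.eval_X]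
    ring
  have hc0 : c 0 = (0, 0, 0, w) := by simp [hc, hk]
  have hc1 : c 1 = (q, e, b₁, w) := by simp [hc]
  have hp0 : p.eval 0 ≠ 0 := by
    rw [← hpe, hc0, chartMapAt_zero_hom_shear hd hk]
    exact Complex.exp_ne_zero w
  have hp1 : p.eval 1 ≠ 0 := by
    rw [← hpe, hc1]
    exact hη
  have hpne : p ≠ 0 := by
    rintro h
    rw [h] at hp0
    simp at hp0
  have hconn : IsPathConnected ({l : ℂ | p.IsRoot l}ᶜ) :=
    (Polynomial.finite_setOfPred_isRoot hpne).countable.isPathConnected_compl_of_one_lt_rank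
      (by simp [Complex.rank_real_complex])
  obtain ⟨γ, hγ⟩ := hconn.joinedIn 0 hp0 1 hp1
  rw [← hc0, ← hc1]
  have hcont : Continuous fun l => chartMapAt hd ξ (c l) :=
    (continuous_chartMapAt hd ξ).comp (by fun_prop)
  refine ⟨γ.map hcont, fun t => ⟨chartMapAt_mem_chartSet hd ξ _, ?_⟩⟩
  change (chartMapAt hd ξ (c (γ t))).1.hom _ ≠ 0
  rw [hpe]
  exact hγ t

theorem exists_lift_chartMapAt (hk : k ≠ 0) (ξ : ℂ) {P : puncturedY (k + 2)}
    (γ : Path (chartMap hd (0, 0, 0, 0)) P) (hγ : ∀ t, γ t ∈ chartSet hd ξ) :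
    ∃ w, Complex.exp w = P.1.hom (shear (one_le_two.trans hd) ξ (bNat (k + 2) 0)) ∧
    ∃ Γ : Path ((0, 0, 0, 0) : ℂ × ℂ × ℂ × ℂ) ((shearMap hd ξ P).1.hom (q (k + 2)),
        (shearMap hd ξ P).1.hom (e (k + 2)), (shearMap hd ξ P).1.hom (bNat (k + 2) 1), w),
      ∀ t, chartMapAt hd ξ (Γ t) = γ t := by
  have hcont : ∀ f, Continuous fun t => (shearMap hd ξ (γ t)).1.hom f := fun f =>
    (Y.continuous_hom f).comp (continuous_subtype_val.comp
      ((continuous_shearMap hd ξ).comp γ.continuous))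
  obtain ⟨w, hwc, hw0, hw⟩ := exists_exp_lift
    (fun t => (shearMap hd ξ (γ t)).1.hom (bNat (k + 2) 0)) (hcont _) hγ (by
      rw [γ.source, shearMap_base hd hk, chartMap_bNat hd _ (Nat.zero_le _)]
      simp [chartB])
  refine ⟨w 1, by rw [hw 1, γ.target, hom_shearMap],
    ⟨⟨fun t => ((shearMap hd ξ (γ t)).1.hom (q (k + 2)),
        (shearMap hd ξ (γ t)).1.hom (e (k + 2)), (shearMap hd ξ (γ t)).1.hom (bNat (k + 2) 1), w t),
        ?_⟩, ?_, ?_⟩, fun t => chartMapAt_eq hd (hw t)⟩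
  · exact (hcont _).prodMk ((hcont _).prodMk ((hcont _).prodMk hwc))
  · have hb : (chartMap hd (0, 0, 0, 0)).1.hom (bNat (k + 2) 1) = 0 := by
      rw [chartMap_bNat hd _ (by omega)]
      exact chartB_origin k hk _ 0 (by omega)
    have hq : (chartMap hd (0, 0, 0, 0)).1.hom (q (k + 2)) = 0 := chartMap_gen hd _ (Sum.inl 0)
    have he : (chartMap hd (0, 0, 0, 0)).1.hom (e (k + 2)) = 0 := chartMap_gen hd _ (Sum.inl 2)
    simp only [γ.source, shearMap_base hd hk, hb, hq, he, hw0]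
  · simp only [γ.target]

/-- The fundamental group of a chart dies in `𝒴(d) ∖ {0}`: it is generated by a loop of `b₀` around
`0`, which bounds a disc in the curve `discMap`. -/
theorem homotopic_of_mem_chartSet (hk : k ≠ 0) (ξ : ℂ) {P : puncturedY (k + 2)}
    (γ γ' : Path (chartMap hd (0, 0, 0, 0)) P) (hγ : ∀ t, γ t ∈ chartSet hd ξ)
    (hγ' : ∀ t, γ' t ∈ chartSet hd ξ) : γ.Homotopic γ' := by
  obtain ⟨w, hw, Γ, hΓ⟩ := exists_lift_chartMapAt hd hk ξ γ hγ
  obtain ⟨w', hw', Γ', hΓ'⟩ := exists_lift_chartMapAt hd hk ξ γ' hγ'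
  obtain ⟨n, rfl⟩ := Complex.exp_eq_exp_iff_exists_int.1 (hw'.trans hw.symm)
  -- The endpoints of the two lifts differ by a period of the exponential.
  set T : ℂ × ℂ × ℂ × ℂ → ℂ × ℂ × ℂ × ℂ :=
    fun u => u + (0, 0, 0, n * (2 * Real.pi * Complex.I)) with hT
  have hfT : ∀ u, chartMapAt hd ξ (T u) = chartMapAt hd ξ u := fun u =>
    congrArg (shearMap hd (-ξ)) (chartMap_add_period hd u n)
  let m : ℂ × ℂ × ℂ × ℂ := (1, 2, 0, 0)
  let z : I → ℂ := fun t => (t : ℝ) * (n * (2 * Real.pi * Complex.I))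
  have hz : Continuous z := by fun_prop
  have hz1 : Complex.exp (z 1) = 1 := by
    simp only [z, Set.Icc.coe_one, Complex.ofReal_one, one_mul]
    exact Complex.exp_int_mul_two_pi_mul_I n
  let L : Path m (T m) :=
    { toFun := fun t => (1, 2, Complex.exp (z t) - 1, z t)
      continuous_toFun := by fun_prop
      source' := by simp [z, m]
      target' := by
        rw [hz1]
        simp [z, m, hT] }
  -- The path `L` has the same image as the loop `D` under `discMap`, and `D` contracts in `ℂ`.
  let D : Path (1 : ℂ) 1 :=
    { toFun := fun t => Complex.exp (z t)
      continuous_toFun := by fun_prop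
      source' := by simp [z]
      target' := hz1 }
  have hdisc : Continuous fun s => shearMap hd (-ξ) (discMap hd s) :=
    (continuous_shearMap hd _).comp (continuous_discMap hd)
  have hm : chartMapAt hd ξ m = shearMap hd (-ξ) (discMap hd 1) := by
    have := chartMap_disc hd 0
    rw [Complex.exp_zero, sub_self] at this
    exact congrArg (shearMap hd (-ξ)) this
  let ℓ : Path (chartMapAt hd ξ m) (chartMapAt hd ξ m) := (D.map hdisc).cast hm hm
  have hL : ∀ t, chartMapAt hd ξ (L t) = ℓ t := fun t =>
    congrArg (shearMap hd (-ξ)) (chartMap_disc hd (z t))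
  have hℓ : ℓ.Homotopic (.refl _) :=
    homotopic_of_lifts hdisc (Γ := D) (Γ' := .refl 1) (fun t => rfl) fun t => hm.symm
  have hend : T ((shearMap hd ξ P).1.hom (q (k + 2)), (shearMap hd ξ P).1.hom (e (k + 2)),
      (shearMap hd ξ P).1.hom (bNat (k + 2) 1), w) = ((shearMap hd ξ P).1.hom (q (k + 2)),
      (shearMap hd ξ P).1.hom (e (k + 2)), (shearMap hd ξ P).1.hom (bNat (k + 2) 1),
      w + n * (2 * Real.pi * Complex.I)) := by
    simp [hT]
  exact homotopic_of_deck (continuous_chartMapAt hd ξ) (T := T) (by fun_prop) hfT hL hℓ hΓ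
    (Γ' := Γ'.cast rfl hend) hΓ'

end Homotopy

end DihedralBlowup

end

theorem proposition4p2 (d : ℕ) (hd : 4 ≤ d) :
    SimplyConnectedSpace (DihedralBlowup.puncturedY d) := by
  obtain ⟨k, rfl⟩ : ∃ k, d = k + 2 := ⟨d - 2, by omega⟩
  have hk : k ≠ 0 := by omega
  have h2 : 2 ≤ k + 2 := by omega
  refine DihedralBlowup.simplyConnectedSpace_of_cover (DihedralBlowup.chartSet h2)
    (DihedralBlowup.isOpen_chartSet h2) (DihedralBlowup.chartMap h2 (0, 0, 0, 0))
    (fun P => (DihedralBlowup.mem_puncturedY_iff h2 P.1).1 P.2)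
    (fun ξ η P hξ hη => DihedralBlowup.joinedIn_chartSet h2 hk hξ hη)
    fun ξ P γ γ' hγ hγ' => DihedralBlowup.homotopic_of_mem_chartSet h2 hk ξ γ γ' hγ hγ'
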